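/- Let $k$ be a field and let $A=\bigoplus_{i\in\mathbb Z}A^i$ be a finite-dimensional graded $k$-algebra which is non-positively graded ($A^i=0$ for $i>0$) and self-injective ($A$ is injective as a right $A$-module). Let $A\text{-grstab}$ be the graded stable category: its objects are the finitely generated graded right $A$-modules, and its morphisms are the degree-preserving $A$-linear maps modulo those that factor through a finitely generated graded projective module. For a graded module $X$ let $X(n)$ be its grading shift, $X(n)^i=X^{i+n}$, and let $\Omega X=\ker(X\otimes_k A\to X)$ be the kernel of the multiplication map, so that $\Omega X\cong X\otimes_A\ker(A\otimes_kA\to A)$. Then $X\mapsto\Omega(1)X:=(\Omega X)(1)$ is an autoequivalence of $A\text{-grstab}$; write $\Omega^n(n)$, $n\in\mathbb Z$, for its powers (with a quasi-inverse used for $n<0$ and the canonical isomorphisms between composites of powers). Let $\mathcal C(A)=A\text{-grstab}/\Omega(1)$ be the orbit category, with the same objects as $A\text{-grstab}$, with $$\operatorname{Hom}_{\mathcal C(A)}(X,Y)=\bigoplus_{n\in\mathbb Z}\operatorname{Hom}_{A\text{-grstab}}(X,\Omega^nY(n)),$$ and with composition $(g\circ f)_j=\sum_{i}\Omega^i(g_{j-i})(i)\circ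 f_i$. (a) $\mathcal C(A)$ is a Krull–Schmidt category: it is additive and every object is isomorphic to a finite direct sum of objects with local endomorphism rings. (b) An object $X$ is indecomposable in $\mathcal C(A)$ if and only if it is indecomposable in $A\text{-grstab}$. In this case $\operatorname{End}_{\mathcal C(A)}(X)=\bigoplus_{n}V_n$, where $V_n=\operatorname{Hom}_{A\text{-grstab}}(X,\Omega^nX(n))$, is a local ring with Jacobson radical $$\operatorname{rad}(V_0)\oplus\bigoplus_{n\neq0}V_n ,$$ where $V_0=\operatorname{End}_{A\text{-grstab}}(X)$. -/

import Mathlib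

open CategoryTheory CategoryTheory.Limits

universe v u

set_option linter.unusedSectionVars false

section Powers

variable {C : Type u} [Category.{v} C]

/-- The `n`-th iterate of an endofunctor. -/
def CategoryTheory.Functor.npow (F : C ⥤ C) : ℕ → (C ⥤ C)
  | 0 => 𝟭 C
  | n + 1 => F.npow n ⋙ F

/-- The integral powers of an autoequivalence `F`: iterates of `F` for `n ≥ 0`, iterates of a
quasi-inverse of `F` for `n < 0`. -/
noncomputable def CategoryTheory.Functor.zpow (F : C ⥤ C) [F.IsEquivalence] : ℤ → (C ⥤ C)
  | Int.ofNat n => F.npow n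
  | Int.negSucc n => F.inv.npow (n + 1)

namespace AutPow

variable (F : C ⥤ C) [F.IsEquivalence]

/-- The canonical isomorphism `F (F ^ n) ≅ F ^ (n + 1)`. -/
noncomputable def step : ∀ n : ℤ, F.zpow n ⋙ F ≅ F.zpow (n + 1)
  | Int.ofNat _ => Iso.refl _
  | Int.negSucc 0 => F.asEquivalence.counitIso
  | Int.negSucc (n + 1) =>
      Functor.isoWhiskerLeft (F.inv.npow (n + 1)) F.asEquivalence.counitIso

/-- A sequence of objects `X n` with `F (X n) ≅ X (n + 1)`. -/
structure Seq where
  obj : ℤ → C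
  iso : ∀ n, F.obj (obj n) ≅ obj (n + 1)

variable {F}

/-- Families of morphisms compatible with the structure isomorphisms. -/
def Compat (X Y : Seq F) (f : ∀ n, X.obj n ⟶ Y.obj n) : Prop :=
  ∀ n, (X.iso n).hom ≫ f (n + 1) = F.map (f n) ≫ (Y.iso n).hom

theorem Compat.ext {X Y : Seq F} {f g : ∀ n, X.obj n ⟶ Y.obj n} (hf : Compat X Y f)
    (hg : Compat X Y g) (h : f 0 = g 0) (n : ℤ) : f n = g n := by
  have key : ∀ n, f n = g n ↔ f (n + 1) = g (n + 1) := by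
    intro n
    constructor
    · intro e
      rw [← cancel_epi (X.iso n).hom, hf n, hg n, e]
    · intro e
      apply F.map_injective
      rw [← cancel_mono (Y.iso n).hom, ← hf n, ← hg n, e]
  induction n using Int.induction_on with
  | zero => exact h
  | succ i hi => exact (key _).1 hi
  | pred i hi =>
    refine (key _).2 ?_
    have e : (-(i : ℤ) - 1 + 1) = -i := by ring
    rw [e]
    exact hi

theorem Compat.id (X : Seq F) : Compat X X (fun _ => 𝟙 _) := fun n => by simp

theorem Compat.comp {X Y Z : Seq F} {f : ∀ n, X.obj n ⟶ Y.obj n} {g : ∀ n, Y.obj n ⟶ Z.obj n}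
    (hf : Compat X Y f) (hg : Compat Y Z g) : Compat X Z (fun n => f n ≫ g n) := fun n => by
  rw [← Category.assoc, hf n, Category.assoc, hg n, Functor.map_comp, Category.assoc]

/-- The extension of a morphism in degree `0` to a compatible family. -/
noncomputable def extend (X Y : Seq F) (f : X.obj 0 ⟶ Y.obj 0) : ∀ n : ℤ, X.obj n ⟶ Y.obj n
  | Int.ofNat 0 => f
  | Int.ofNat (n + 1) =>
      (X.iso (Int.ofNat n)).inv ≫ F.map (extend X Y f (Int.ofNat n)) ≫ (Y.iso (Int.ofNat n)).hom
  | Int.negSucc 0 => F.preimage ((X.iso (Int.negSucc 0)).hom ≫ f ≫ (Y.iso (Int.negSucc 0)).inv)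
  | Int.negSucc (n + 1) => F.preimage ((X.iso (Int.negSucc (n + 1))).hom ≫
      extend X Y f (Int.negSucc n) ≫ (Y.iso (Int.negSucc (n + 1))).inv)
  termination_by n => n.natAbs

theorem extend_zero (X Y : Seq F) (f : X.obj 0 ⟶ Y.obj 0) : extend X Y f 0 = f := by
  change extend X Y f (Int.ofNat 0) = f
  rw [extend]

theorem extend_compat (X Y : Seq F) (f : X.obj 0 ⟶ Y.obj 0) : Compat X Y (extend X Y f) := by
  intro n
  match n with
  | Int.ofNat n =>
    change _ ≫ extend X Y f (Int.ofNat (n + 1)) = _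
    rw [extend]
    erw [Iso.hom_inv_id_assoc]
  | Int.negSucc 0 =>
    change _ ≫ extend X Y f (Int.ofNat 0) = _
    rw [extend, extend, F.map_preimage, Category.assoc, Category.assoc]
    erw [Iso.inv_hom_id, Category.comp_id]
  | Int.negSucc (n + 1) =>
    change _ ≫ extend X Y f (Int.negSucc n) = _
    rw [extend.eq_4 _ _ _ n, F.map_preimage, Category.assoc, Category.assoc]
    erw [Iso.inv_hom_id, Category.comp_id]

variable (F)

/-- The sequence `n ↦ F ^ n X`. -/
@[simps] noncomputable def powSeq (X : C) : Seq F where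
  obj n := (F.zpow n).obj X
  iso n := (step F n).app X

variable {F}

/-- The sequence `n ↦ X (m + n)`. -/
@[simps] noncomputable def Seq.shift (X : Seq F) (m : ℤ) : Seq F where
  obj n := X.obj (m + n)
  iso n := X.iso (m + n) ≪≫ eqToIso (congrArg X.obj (add_assoc m n 1))

theorem Compat.shift {X Y : Seq F} {f : ∀ n, X.obj n ⟶ Y.obj n} (hf : Compat X Y f) (m : ℤ) :
    Compat (X.shift m) (Y.shift m) (fun n => f (m + n)) := by
  intro n
  have aux : ∀ {a b : ℤ} (h : a = b),
      eqToHom (by rw [h]) ≫ f b = f a ≫ eqToHom (by rw [h]) := by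
    rintro a b rfl
    simp
  have h := hf (m + n)
  change ((X.iso (m + n)).hom ≫ eqToHom (congrArg X.obj (add_assoc m n 1))) ≫
      f (m + (n + 1)) =
    F.map (f (m + n)) ≫ (Y.iso (m + n)).hom ≫ eqToHom (congrArg Y.obj (add_assoc m n 1))
  rw [Category.assoc, aux (add_assoc m n 1), reassoc_of% h]

theorem Compat.eqToHom_assoc (X : Seq F) (a b : ℤ) :
    Compat (X.shift (a + b)) ((X.shift a).shift b)
      (fun n => eqToHom (congrArg X.obj (add_assoc a b n))) := by
  intro n
  have aux : ∀ {i j : ℤ} (h : i = j),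
      F.map (eqToHom (congrArg X.obj h)) ≫ (X.iso j).hom =
        (X.iso i).hom ≫ eqToHom (by rw [h]) := by
    rintro i j rfl
    simp
  change ((X.iso (a + b + n)).hom ≫ eqToHom (congrArg X.obj (add_assoc (a + b) n 1))) ≫
      eqToHom (congrArg X.obj (add_assoc a b (n + 1))) =
    F.map (eqToHom (congrArg X.obj (add_assoc a b n))) ≫
      ((X.iso (a + (b + n))).hom ≫ eqToHom (congrArg X.obj (add_assoc a (b + n) 1))) ≫
        eqToHom (congrArg (fun i => X.obj (a + i)) (add_assoc b n 1))
  rw [← Category.assoc (F.map _), ← Category.assoc (F.map _), aux (add_assoc a b n)]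
  simp only [Category.assoc, eqToHom_trans]

theorem Compat.eqToHom_zero (X : Seq F) :
    Compat (X.shift 0) X (fun n => eqToHom (congrArg X.obj (zero_add n))) := by
  intro n
  have aux : ∀ {i j : ℤ} (h : i = j),
      F.map (eqToHom (congrArg X.obj h)) ≫ (X.iso j).hom =
        (X.iso i).hom ≫ eqToHom (by rw [h]) := by
    rintro i j rfl
    simp
  change ((X.iso (0 + n)).hom ≫ eqToHom (congrArg X.obj (add_assoc 0 n 1))) ≫
      eqToHom (congrArg X.obj (zero_add (n + 1))) =
    F.map (eqToHom (congrArg X.obj (zero_add n))) ≫ (X.iso n).hom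
  rw [aux (zero_add n)]
  simp only [Category.assoc, eqToHom_trans]

variable (F)

theorem compat_map {X Y : C} (f : X ⟶ Y) :
    Compat (powSeq F X) (powSeq F Y) (fun n => (F.zpow n).map f) := fun n =>
  ((step F n).hom.naturality f).symm

/-- The family of canonical morphisms `F ^ (m + n) X ⟶ F ^ n (F ^ m X)`. -/
noncomputable def addHom (m : ℤ) (X : C) :
    ∀ n, (F.zpow (m + n)).obj X ⟶ (F.zpow n).obj ((F.zpow m).obj X) :=
  extend ((powSeq F X).shift m) (powSeq F ((F.zpow m).obj X))
    (eqToHom (by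
      change (F.zpow (m + 0)).obj X = (F.zpow m).obj X
      rw [add_zero]))

/-- The inverse family of `addHom`. -/
noncomputable def addInv (m : ℤ) (X : C) :
    ∀ n, (F.zpow n).obj ((F.zpow m).obj X) ⟶ (F.zpow (m + n)).obj X :=
  extend (powSeq F ((F.zpow m).obj X)) ((powSeq F X).shift m)
    (eqToHom (by
      change (F.zpow m).obj X = (F.zpow (m + 0)).obj X
      rw [add_zero]))

theorem addHom_compat (m : ℤ) (X : C) :
    Compat ((powSeq F X).shift m) (powSeq F ((F.zpow m).obj X)) (addHom F m X) :=
  extend_compat _ _ _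

theorem addInv_compat (m : ℤ) (X : C) :
    Compat (powSeq F ((F.zpow m).obj X)) ((powSeq F X).shift m) (addInv F m X) :=
  extend_compat _ _ _

theorem addHom_zero (m : ℤ) (X : C) : addHom F m X 0 = eqToHom (by
    change (F.zpow (m + 0)).obj X = (F.zpow m).obj X
    rw [add_zero]) := extend_zero _ _ _

theorem addInv_zero (m : ℤ) (X : C) : addInv F m X 0 = eqToHom (by
    change (F.zpow m).obj X = (F.zpow (m + 0)).obj X
    rw [add_zero]) := extend_zero _ _ _

/-- The canonical isomorphism `F ^ (m + n) ≅ F ^ n F ^ m`. -/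
noncomputable def addIso (m n : ℤ) : F.zpow (m + n) ≅ F.zpow m ⋙ F.zpow n :=
  NatIso.ofComponents (fun X =>
    { hom := addHom F m X n
      inv := addInv F m X n
      hom_inv_id := Compat.ext ((addHom_compat F m X).comp (addInv_compat F m X)) (Compat.id _)
        (by rw [addHom_zero, addInv_zero]; exact eqToHom_trans _ _) n
      inv_hom_id := Compat.ext ((addInv_compat F m X).comp (addHom_compat F m X)) (Compat.id _)
        (by rw [addHom_zero, addInv_zero]; exact eqToHom_trans _ _) n })
    (fun {X Y} f => Compat.ext (((compat_map F f).shift m).comp (addHom_compat F m Y))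
      ((addHom_compat F m X).comp (compat_map F ((F.zpow m).map f)))
      (by
        rw [addHom_zero, addHom_zero]
        have aux : ∀ {a b : ℤ} (h : a = b), (F.zpow a).map f ≫ eqToHom (by rw [h]) =
            eqToHom (by rw [h]) ≫ (F.zpow b).map f := by
          rintro a b rfl
          simp
        exact aux (add_zero m)) n)

/-- The integral powers of `F` with the isomorphisms `F ^ (m + n) ≅ F ^ n F ^ m`, which are
coherent: a family of morphisms compatible with the isomorphisms `F (F ^ n) ≅ F ^ (n + 1)` is
determined by its member in degree zero. -/
noncomputable def core : ShiftMkCore C ℤ where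
  F := F.zpow
  zero := Iso.refl _
  add := addIso F
  assoc_hom_app m₁ m₂ m₃ X := by
    refine Compat.ext
      ((addHom_compat F (m₁ + m₂) X).comp (compat_map F (addHom F m₁ X m₂)))
      ((Compat.eqToHom_assoc (powSeq F X) m₁ m₂).comp
        (((addHom_compat F m₁ X).shift m₂).comp (addHom_compat F m₂ ((F.zpow m₁).obj X)))) ?_ m₃
    rw [addHom_zero, addHom_zero]
    have aux : ∀ {i j : ℤ} (h : i = j), addHom F m₁ X i ≫ eqToHom (by rw [h]) =
        eqToHom (by rw [h]) ≫ addHom F m₁ X j := by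
      rintro i j rfl
      simp
    refine Eq.trans ?_ (congrArg (fun t => eqToHom _ ≫ t) (aux (add_zero m₂)).symm)
    exact (eqToHom_trans_assoc _ _ _).symm
  zero_add_hom_app n X := by
    refine (Compat.ext (addHom_compat F 0 X) (Compat.eqToHom_zero (powSeq F X)) ?_ n).trans ?_
    · exact addHom_zero F 0 X
    · refine Eq.symm (Eq.trans (congrArg (fun t => eqToHom _ ≫ t) ((F.zpow n).map_id X)) ?_)
      exact Category.comp_id _
  add_zero_hom_app n X := by
    refine (addHom_zero F n X).trans ?_
    exact (Category.comp_id _).symm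

end AutPow
end Powers

section Orbit

variable {C : Type u} [Category.{v} C]

/-- The orbit category `C / F` of an autoequivalence `F`: it has the objects of `C`. -/
structure OrbitCategory (F : C ⥤ C) where
  /-- The object of the orbit category given by an object of `C`. -/
  of ::
  /-- The underlying object of `C`. -/
  obj : C

namespace OrbitCategory

open DirectSum AutPow

variable [Preadditive C] (F : C ⥤ C) [F.IsEquivalence] [F.Additive]

instance npow_additive (G : C ⥤ C) [G.Additive] : ∀ n, (G.npow n).Additive
  | 0 => inferInstanceAs (𝟭 C).Additive
  | n + 1 =>
    have := npow_additive G n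
    inferInstanceAs (G.npow n ⋙ G).Additive

instance inv_additive : F.inv.Additive :=
  have : F.asEquivalence.functor.Additive := ‹F.Additive›
  inferInstanceAs F.asEquivalence.inverse.Additive

instance zpow_additive : ∀ n, (F.zpow n).Additive
  | Int.ofNat n => inferInstanceAs (F.npow n).Additive
  | Int.negSucc n => inferInstanceAs (F.inv.npow (n + 1)).Additive

/-- The identification `F ^ 0 ≅ id`. -/
noncomputable def zeroIso : F.zpow 0 ≅ 𝟭 C := (core F).zero

/-- The composite `F ^ i (g) ∘ f : X ⟶ F ^ (j + i) Z` of homogeneous morphisms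
`f : X ⟶ F ^ i Y` and `g : Y ⟶ F ^ j Z`, as a biadditive map. -/
noncomputable def homogComp (X Y Z : C) (i j : ℤ) :
    (X ⟶ (F.zpow i).obj Y) →+ (Y ⟶ (F.zpow j).obj Z) →+ (X ⟶ (F.zpow (j + i)).obj Z) :=
  AddMonoidHom.mk' (fun f => AddMonoidHom.mk'
      (fun g => f ≫ (F.zpow i).map g ≫ (addIso F j i).inv.app Z)
      (fun g g' => by simp [Functor.map_add]))
    (fun f f' => by ext g; simp)

/-- Morphisms `X ⟶ Y` in the orbit category: `⨁ n, Hom (X, F ^ n Y)`. -/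
abbrev Hom (X Y : OrbitCategory F) : Type v := ⨁ n : ℤ, (X.obj ⟶ (F.zpow n).obj Y.obj)

/-- Composition in the orbit category, `(g ∘ f)_n = ∑ i, F ^ i (g_(n - i)) ∘ f_i`. -/
noncomputable def compHom (X Y Z : OrbitCategory F) : Hom F X Y →+ Hom F Y Z →+ Hom F X Z :=
  DirectSum.toAddMonoid fun i => AddMonoidHom.flip <| DirectSum.toAddMonoid fun j =>
    AddMonoidHom.flip <|
      (AddMonoidHom.compHom
        (DirectSum.of (fun n : ℤ => X.obj ⟶ (F.zpow n).obj Z.obj) (j + i))).comp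
          (homogComp F X.obj Y.obj Z.obj i j)

/-- The homogeneous morphism of degree `n` given by `f : X ⟶ F ^ n Y`. -/
noncomputable abbrev homog {X Y : OrbitCategory F} (n : ℤ)
    (f : X.obj ⟶ (F.zpow n).obj Y.obj) : Hom F X Y :=
  DirectSum.of (fun n : ℤ => X.obj ⟶ (F.zpow n).obj Y.obj) n f

theorem compHom_homog {X Y Z : OrbitCategory F} (i j : ℤ) (f : X.obj ⟶ (F.zpow i).obj Y.obj)
    (g : Y.obj ⟶ (F.zpow j).obj Z.obj) :
    compHom F X Y Z (homog F i f) (homog F j g) =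
      homog F (j + i) (f ≫ (F.zpow i).map g ≫ (addIso F j i).inv.app Z.obj) := by
  simp [compHom, homog, homogComp]

theorem homog_congr {X Y : OrbitCategory F} {i j : ℤ} (h : i = j)
    (f : X.obj ⟶ (F.zpow i).obj Y.obj) :
    homog F i f = homog F j (f ≫ eqToHom (by rw [h])) := by
  subst h
  simp

noncomputable instance : Category.{v} (OrbitCategory F) where
  Hom X Y := Hom F X Y
  id X := homog F 0 ((zeroIso F).inv.app X.obj)
  comp {X Y Z} f g := compHom F X Y Z f g
  id_comp {X Y} f := by
    change compHom F X X Y (homog F 0 ((zeroIso F).inv.app X.obj)) f = f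
    induction f using DirectSum.induction_on with
    | zero => simp
    | add f g hf hg => rw [map_add, hf, hg]
    | of n f =>
      rw [compHom_homog, homog_congr F (add_zero n)]
      have h : (addIso F n 0).inv.app Y.obj =
          (zeroIso F).hom.app ((F.zpow n).obj Y.obj) ≫ eqToHom (by rw [add_zero]; rfl) :=
        (core F).add_zero_inv_app n Y.obj
      have h' : (zeroIso F).inv.app X.obj ≫ (F.zpow 0).map f =
          f ≫ (zeroIso F).inv.app _ := ((zeroIso F).inv.naturality f).symm
      rw [h, reassoc_of% h']
      simp
  comp_id {X Y} f := by
    change compHom F X Y Y f (homog F 0 ((zeroIso F).inv.app Y.obj)) = f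
    induction f using DirectSum.induction_on with
    | zero => simp
    | add f g hf hg => rw [map_add, AddMonoidHom.add_apply, hf, hg]
    | of n f =>
      rw [compHom_homog, homog_congr F (zero_add n)]
      have h : (addIso F 0 n).inv.app Y.obj =
          (F.zpow n).map ((zeroIso F).hom.app Y.obj) ≫ eqToHom (by rw [zero_add]; rfl) :=
        (core F).zero_add_inv_app n Y.obj
      have h' : (F.zpow n).map ((zeroIso F).inv.app Y.obj) ≫
          (F.zpow n).map ((zeroIso F).hom.app Y.obj) = 𝟙 _ := by
        rw [← Functor.map_comp, Iso.inv_hom_id_app]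
        exact CategoryTheory.Functor.map_id _ _
      rw [h, reassoc_of% h']
      simp
  assoc {X Y Z W} f g h := by
    change compHom F X Z W (compHom F X Y Z f g) h = compHom F X Y W f (compHom F Y Z W g h)
    induction f using DirectSum.induction_on with
    | zero => simp
    | add f f' hf hf' => simp only [map_add, AddMonoidHom.add_apply, hf, hf']
    | of i f =>
    induction g using DirectSum.induction_on with
    | zero => simp
    | add f f' hf hf' => simp only [map_add, AddMonoidHom.add_apply, hf, hf']
    | of j g =>
    induction h using DirectSum.induction_on with
    | zero => simp
    | add f f' hf hf' => simp only [map_add, hf, hf']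
    | of k h =>
      rw [compHom_homog, compHom_homog, compHom_homog, compHom_homog,
        homog_congr F (add_assoc k j i).symm]
      congr 1
      have e : (F.zpow i).map ((addIso F k j).inv.app W.obj) ≫ (addIso F (k + j) i).inv.app W.obj =
          (addIso F j i).inv.app ((F.zpow k).obj W.obj) ≫ (addIso F k (j + i)).inv.app W.obj ≫
            eqToHom (by rw [add_assoc]) := (core F).assoc_inv_app k j i W.obj
      have e' : (addIso F j i).inv.app Z.obj ≫ (F.zpow (j + i)).map h =
          (F.zpow i).map ((F.zpow j).map h) ≫ (addIso F j i).inv.app ((F.zpow k).obj W.obj) :=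
        ((addIso F j i).inv.naturality h).symm
      simp only [Category.assoc, Functor.map_comp, e, reassoc_of% e']

noncomputable instance : Preadditive (OrbitCategory F) where
  homGroup X Y := inferInstanceAs (AddCommGroup (Hom F X Y))
  add_comp X Y Z (f f' : Hom F X Y) g := by
    change compHom F X Y Z (f + f') g = compHom F X Y Z f g + compHom F X Y Z f' g
    rw [map_add, AddMonoidHom.add_apply]
  comp_add X Y Z f (g g' : Hom F Y Z) := by
    change compHom F X Y Z f (g + g') = compHom F X Y Z f g + compHom F X Y Z f g'
    rw [map_add]

/-- The natural functor `C ⥤ C / F`, placing morphisms in degree `0`. -/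
noncomputable def proj : C ⥤ OrbitCategory F where
  obj X := of X
  map {X Y} f := homog F (X := of X) (Y := of Y) 0 (f ≫ (zeroIso F).inv.app Y)
  map_id X := by
    rw [Category.id_comp]
    rfl
  map_comp {X Y Z} f g := by
    refine Eq.symm ((compHom_homog F (X := of X) (Y := of Y) (Z := of Z) 0 0 _ _).trans ?_)
    have h : (addIso F 0 0).inv.app Z =
        (zeroIso F).hom.app ((F.zpow 0).obj Z) ≫ eqToHom (by rw [add_zero]; rfl) :=
      (core F).add_zero_inv_app 0 Z
    have h' : (zeroIso F).inv.app Y ≫ (F.zpow 0).map (g ≫ (zeroIso F).inv.app Z) =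
        (g ≫ (zeroIso F).inv.app Z) ≫ (zeroIso F).inv.app ((F.zpow 0).obj Z) :=
      ((zeroIso F).inv.naturality _).symm
    rw [homog_congr F (add_zero 0)]
    simp only [Category.assoc, h, reassoc_of% h']
    simp

instance : (proj F).Additive where
  map_add {X Y f g} := by
    change homog F (X := of X) (Y := of Y) 0 _ = homog F (X := of X) (Y := of Y) 0 _ +
      homog F (X := of X) (Y := of Y) 0 _
    rw [Preadditive.add_comp]
    exact map_add _ _ _

/-- The component in degree zero of an endomorphism in the orbit category, as an endomorphism
in the original category. -/
noncomputable def degZero {X : C} (f : End ((proj F).obj X)) : End X :=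
  (show Hom F (of X) (of X) from f) 0 ≫ (zeroIso F).hom.app X

end OrbitCategory
end Orbit

section Graded

open DirectSum TensorProduct

namespace GradedAux

variable {k M N : Type*} [Field k] [AddCommGroup M] [Module k M] [AddCommGroup N] [Module k N]

theorem exists_proj {ℳ : ℤ → Submodule k M} (h : DirectSum.IsInternal ℳ) :
    ∃ p : ℤ → M →ₗ[k] M, (∀ n x, p n x ∈ ℳ n) ∧ (∀ n, ∀ x ∈ ℳ n, p n x = x) ∧
      (∀ m n, m ≠ n → ∀ x ∈ ℳ n, p m x = 0) ∧ ∀ x, ∃ s : Finset ℤ, ∑ n ∈ s, p n x = x := by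
  classical
  let e := LinearEquiv.ofBijective (DirectSum.coeLinearMap ℳ) h
  have he : ∀ n (x : ℳ n), e.symm (x : M) = DirectSum.lof k ℤ (fun i => ℳ i) n x := by
    intro n x
    rw [LinearEquiv.symm_apply_eq]
    exact (DirectSum.coeLinearMap_lof ℳ n x).symm
  refine ⟨fun n => (ℳ n).subtype ∘ₗ DirectSum.component k ℤ (fun i => ℳ i) n ∘ₗ
    e.symm.toLinearMap, fun n x => Subtype.property _, ?_, ?_, ?_⟩
  · intro n x hx
    have := he n ⟨x, hx⟩
    simp only [LinearMap.comp_apply, LinearEquiv.coe_coe]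
    rw [this, DirectSum.component.lof_self]
    rfl
  · intro m n hmn x hx
    have := he n ⟨x, hx⟩
    simp only [LinearMap.comp_apply, LinearEquiv.coe_coe]
    rw [this, DirectSum.component.of, dif_neg hmn.symm]
    rfl
  · intro x
    refine ⟨(e.symm x).support, ?_⟩
    conv_rhs => rw [← e.apply_symm_apply x]
    change _ = DirectSum.coeLinearMap ℳ (e.symm x)
    rw [DirectSum.coeLinearMap_eq_dfinsuppSum, DFinsupp.sum]
    rfl

theorem isInternal_of_proj {ℳ : ℤ → Submodule k M} (p : ℤ → M →ₗ[k] M)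
    (h₁ : ∀ n, ∀ x ∈ ℳ n, p n x = x) (h₂ : ∀ m n, m ≠ n → ∀ x ∈ ℳ n, p m x = 0)
    (h₃ : ⨆ n, ℳ n = ⊤) : DirectSum.IsInternal ℳ := by
  classical
  rw [DirectSum.isInternal_submodule_iff_iSupIndep_and_iSup_eq_top]
  refine ⟨fun n => ?_, h₃⟩
  rw [Submodule.disjoint_def]
  intro x hx hx'
  rw [← h₁ n x hx]
  have hle : ⨆ m, ⨆ (_ : m ≠ n), ℳ m ≤ LinearMap.ker (p n) :=
    iSup₂_le fun m hm y hy => h₂ n m hm.symm y hy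
  exact hle hx'

theorem iSup_eq_top_of_sum {ℳ : ℤ → Submodule k M} (p : ℤ → M →ₗ[k] M)
    (h₀ : ∀ n x, p n x ∈ ℳ n) (h : ∀ x, ∃ s : Finset ℤ, ∑ n ∈ s, p n x = x) :
    ⨆ n, ℳ n = ⊤ := by
  rw [eq_top_iff]
  rintro x -
  obtain ⟨s, hs⟩ := h x
  rw [← hs]
  exact Submodule.sum_mem _ fun n _ => Submodule.mem_iSup_of_mem n (h₀ n x)

theorem isInternal_prod {ℳ : ℤ → Submodule k M} {𝒩 : ℤ → Submodule k N}
    (hM : DirectSum.IsInternal ℳ) (hN : DirectSum.IsInternal 𝒩) :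
    DirectSum.IsInternal fun n => (ℳ n).prod (𝒩 n) := by
  obtain ⟨p, p₀, p₁, p₂, p₃⟩ := exists_proj hM
  obtain ⟨q, q₀, q₁, q₂, q₃⟩ := exists_proj hN
  refine isInternal_of_proj (fun n => (p n).prodMap (q n)) ?_ ?_ ?_
  · rintro n ⟨x, y⟩ ⟨hx, hy⟩
    exact Prod.ext (p₁ n x hx) (q₁ n y hy)
  · rintro m n hmn ⟨x, y⟩ ⟨hx, hy⟩
    exact Prod.ext (p₂ m n hmn x hx) (q₂ m n hmn y hy)
  · rw [eq_top_iff]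
    rintro ⟨x, y⟩ -
    obtain ⟨s, hs⟩ := p₃ x
    obtain ⟨t, ht⟩ := q₃ y
    have : (x, y) = ∑ n ∈ s, (p n x, (0 : N)) + ∑ n ∈ t, ((0 : M), q n y) := by
      ext <;> simp [Prod.fst_sum, Prod.snd_sum, hs, ht]
    rw [this]
    refine Submodule.add_mem _ ?_ ?_
    · exact Submodule.sum_mem _ fun n _ => Submodule.mem_iSup_of_mem n
        ⟨p₀ n x, Submodule.zero_mem _⟩
    · exact Submodule.sum_mem _ fun n _ => Submodule.mem_iSup_of_mem n
        ⟨Submodule.zero_mem _, q₀ n y⟩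

theorem isInternal_ker {K : Type*} [AddCommGroup K] [Module k K]
    {ℳ : ℤ → Submodule k M} {𝒩 : ℤ → Submodule k N}
    (hM : DirectSum.IsInternal ℳ) (hN : DirectSum.IsInternal 𝒩) (φ : M →ₗ[k] N)
    (hφ : ∀ n, ∀ x ∈ ℳ n, φ x ∈ 𝒩 n) (ι : K →ₗ[k] M) (hι : Function.Injective ι)
    (hex : LinearMap.range ι = LinearMap.ker φ) :
    DirectSum.IsInternal fun n => (ℳ n).comap ι := by
  obtain ⟨p, p₀, p₁, p₂, p₃⟩ := exists_proj hM
  obtain ⟨q, q₀, q₁, q₂, q₃⟩ := exists_proj hN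
  have hcomm : ∀ n x, φ (p n x) = q n (φ x) := by
    intro n x
    obtain ⟨s, hs⟩ := p₃ x
    conv_rhs => rw [← hs]
    conv_lhs => rw [← hs]
    simp only [map_sum]
    refine Finset.sum_congr rfl fun m _ => ?_
    by_cases hmn : n = m
    · subst hmn
      rw [p₁ n _ (p₀ n x), q₁ n _ (hφ n _ (p₀ n x))]
    · rw [p₂ n m hmn _ (p₀ m x), q₂ n m hmn _ (hφ m _ (p₀ m x)), map_zero]
  have hker : ∀ n x, (p n ∘ₗ ι) x ∈ LinearMap.range ι := by
    intro n x
    have hx : ι x ∈ LinearMap.ker φ := hex ▸ LinearMap.mem_range_self ι x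
    rw [LinearMap.mem_ker] at hx
    rw [hex, LinearMap.mem_ker, LinearMap.comp_apply, hcomm, hx, map_zero]
  let r : ℤ → K →ₗ[k] K := fun n =>
    (LinearEquiv.ofInjective ι hι).symm.toLinearMap ∘ₗ (p n ∘ₗ ι).codRestrict _ (hker n)
  have hr : ∀ n x, ι (r n x) = p n (ι x) := fun n x =>
    congrArg Subtype.val ((LinearEquiv.ofInjective ι hι).apply_symm_apply ⟨_, hker n x⟩)
  refine isInternal_of_proj r ?_ ?_ ?_
  · intro n x hx
    exact hι ((hr n x).trans (p₁ n _ hx))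
  · intro m n hmn x hx
    exact hι ((hr m x).trans ((p₂ m n hmn _ hx).trans (map_zero ι).symm))
  · refine iSup_eq_top_of_sum r (fun n x => ?_) ?_
    · rw [Submodule.mem_comap, hr]
      exact p₀ n _
    · intro x
      obtain ⟨s, hs⟩ := p₃ (ι x)
      refine ⟨s, hι ?_⟩
      rw [map_sum, Finset.sum_congr rfl fun n _ => hr n x, hs]

theorem isInternal_shift {ℳ : ℤ → Submodule k M} (hM : DirectSum.IsInternal ℳ) (n : ℤ) :
    DirectSum.IsInternal fun i => ℳ (i + n) := by
  obtain ⟨p, p₀, p₁, p₂, p₃⟩ := exists_proj hM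
  refine isInternal_of_proj (fun i => p (i + n)) (fun i x hx => p₁ _ x hx)
    (fun i j hij x hx => p₂ _ _ (by simpa using hij) x hx) ?_
  have := iSup_eq_top_of_sum p p₀ p₃
  rw [← (Equiv.addRight n).surjective.iSup_comp] at this
  exact this

/-- The degree `n` part `⨆ (i + j = n), Mᵢ ⊗ Nⱼ` of the tensor product of graded spaces. -/
def tensorDeg (ℳ : ℤ → Submodule k M) (𝒩 : ℤ → Submodule k N) (n : ℤ) :
    Submodule k (M ⊗[k] N) :=
  Submodule.span k {t | ∃ i j, i + j = n ∧ ∃ x ∈ ℳ i, ∃ y ∈ 𝒩 j, x ⊗ₜ[k] y = t}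

theorem isInternal_tensor {ℳ : ℤ → Submodule k M} {𝒩 : ℤ → Submodule k N}
    (hM : DirectSum.IsInternal ℳ) (hN : DirectSum.IsInternal 𝒩) :
    DirectSum.IsInternal (tensorDeg ℳ 𝒩) := by
  classical
  obtain ⟨p, p₀, p₁, p₂, p₃⟩ := exists_proj hM
  obtain ⟨q, q₀, q₁, q₂, q₃⟩ := exists_proj hN
  let e := LinearEquiv.ofBijective (DirectSum.coeLinearMap ℳ) hM
  have he : ∀ n (x : ℳ n), e.symm (x : M) = DirectSum.lof k ℤ (fun i => ℳ i) n x := by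
    intro n x
    rw [LinearEquiv.symm_apply_eq]
    exact (DirectSum.coeLinearMap_lof ℳ n x).symm
  let r : ℤ → M ⊗[k] N →ₗ[k] M ⊗[k] N := fun n => TensorProduct.lift
    ((DirectSum.toModule k ℤ (N →ₗ[k] M ⊗[k] N) fun i =>
      ((TensorProduct.mk k M N).compl₂ (q (n - i))) ∘ₗ (ℳ i).subtype) ∘ₗ e.symm.toLinearMap)
  have hr : ∀ n i, ∀ x ∈ ℳ i, ∀ y, r n (x ⊗ₜ y) = x ⊗ₜ q (n - i) y := by
    intro n i x hx y
    have := he i ⟨x, hx⟩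
    simp only [r, TensorProduct.lift.tmul, LinearMap.comp_apply, LinearEquiv.coe_coe]
    rw [this, DirectSum.toModule_lof]
    rfl
  refine isInternal_of_proj r ?_ ?_ ?_
  · intro n t ht
    induction ht using Submodule.span_induction with
    | mem t ht =>
      obtain ⟨i, j, hij, x, hx, y, hy, rfl⟩ := ht
      obtain rfl : j = n - i := by omega
      rw [hr n i x hx, q₁ _ y hy]
    | zero => exact map_zero _
    | add s t _ _ hs ht => rw [map_add, hs, ht]
    | smul c t _ ht => rw [map_smul, ht]
  · intro m n hmn t ht
    induction ht using Submodule.span_induction with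
    | mem t ht =>
      obtain ⟨i, j, hij, x, hx, y, hy, rfl⟩ := ht
      rw [hr m i x hx, q₂ _ j (by omega) y hy, tmul_zero]
    | zero => exact map_zero _
    | add s t _ _ hs ht => rw [map_add, hs, ht, add_zero]
    | smul c t _ ht => rw [map_smul, ht, smul_zero]
  · rw [eq_top_iff]
    rintro t -
    induction t with
    | zero => exact Submodule.zero_mem _
    | add s t hs ht => exact Submodule.add_mem _ hs ht
    | tmul x y =>
      obtain ⟨s, hs⟩ := p₃ x
      obtain ⟨u, hu⟩ := q₃ y
      rw [← hs, ← hu, TensorProduct.sum_tmul]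
      refine Submodule.sum_mem _ fun i _ => ?_
      rw [TensorProduct.tmul_sum]
      refine Submodule.sum_mem _ fun j _ => Submodule.mem_iSup_of_mem (i + j) ?_
      exact Submodule.subset_span ⟨i, j, rfl, _, p₀ i x, _, q₀ j y, rfl⟩

end GradedAux
end Graded

section GradedModules

open DirectSum TensorProduct MulOpposite

variable {k : Type u} {A : Type v} [Field k] [Ring A] [Algebra k A]

/-- Finitely generated graded right modules over the graded algebra `A = ⨁ 𝒜 i`. Right
`A`-modules are modules over `Aᵐᵒᵖ`, with `x * a` written `op a • x`. -/
structure GrMod (𝒜 : ℤ → Submodule k A) where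
  /-- The underlying module. -/
  carrier : Type v
  [addCommGroup : AddCommGroup carrier]
  [moduleField : Module k carrier]
  [moduleOp : Module Aᵐᵒᵖ carrier]
  [isScalarTower : IsScalarTower k Aᵐᵒᵖ carrier]
  [finite : Module.Finite Aᵐᵒᵖ carrier]
  /-- The homogeneous components. -/
  deg : ℤ → Submodule k carrier
  isInternal : DirectSum.IsInternal deg
  op_smul_mem : ∀ {i j : ℤ} {x : carrier} {a : A}, x ∈ deg i → a ∈ 𝒜 j → op a • x ∈ deg (i + j)

namespace GrMod

variable (𝒜 : ℤ → Submodule k A)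

instance : CoeSort (GrMod 𝒜) (Type v) := ⟨carrier⟩

attribute [instance] addCommGroup moduleField moduleOp isScalarTower finite

variable {𝒜}

/-- Morphisms of graded modules: `A`-linear maps preserving degrees. -/
@[ext]
structure Hom (X Y : GrMod 𝒜) where
  /-- The underlying linear map. -/
  lin : X →ₗ[Aᵐᵒᵖ] Y
  map_deg : ∀ i, ∀ x ∈ X.deg i, lin x ∈ Y.deg i

instance : Category (GrMod 𝒜) where
  Hom X Y := Hom X Y
  id X := ⟨LinearMap.id, fun _ _ h => h⟩
  comp f g := ⟨g.lin ∘ₗ f.lin, fun i x h => g.map_deg i _ (f.map_deg i x h)⟩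

@[ext]
theorem hom_ext {X Y : GrMod 𝒜} {f g : X ⟶ Y} (h : f.lin = g.lin) : f = g := Hom.ext h

@[simp] theorem id_lin (X : GrMod 𝒜) : Hom.lin (𝟙 X) = LinearMap.id := rfl

@[simp] theorem comp_lin {X Y Z : GrMod 𝒜} (f : X ⟶ Y) (g : Y ⟶ Z) :
    (f ≫ g).lin = g.lin ∘ₗ f.lin := rfl

instance (X Y : GrMod 𝒜) : Zero (X ⟶ Y) := ⟨⟨0, fun i _ _ => (Y.deg i).zero_mem⟩⟩

instance (X Y : GrMod 𝒜) : Add (X ⟶ Y) :=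
  ⟨fun f g => ⟨f.lin + g.lin, fun i x h => (Y.deg i).add_mem (f.map_deg i x h) (g.map_deg i x h)⟩⟩

instance (X Y : GrMod 𝒜) : Neg (X ⟶ Y) :=
  ⟨fun f => ⟨-f.lin, fun i x h => (Y.deg i).neg_mem (f.map_deg i x h)⟩⟩

instance (X Y : GrMod 𝒜) : Sub (X ⟶ Y) :=
  ⟨fun f g => ⟨f.lin - g.lin, fun i x h => (Y.deg i).sub_mem (f.map_deg i x h) (g.map_deg i x h)⟩⟩

@[simp] theorem zero_lin (X Y : GrMod 𝒜) : Hom.lin (0 : X ⟶ Y) = 0 := rfl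

@[simp] theorem add_lin {X Y : GrMod 𝒜} (f g : X ⟶ Y) : (f + g).lin = f.lin + g.lin := rfl

@[simp] theorem neg_lin {X Y : GrMod 𝒜} (f : X ⟶ Y) : (-f).lin = -f.lin := rfl

@[simp] theorem sub_lin {X Y : GrMod 𝒜} (f g : X ⟶ Y) : (f - g).lin = f.lin - g.lin := rfl

instance (X Y : GrMod 𝒜) : AddCommGroup (X ⟶ Y) where
  add_assoc f g h := hom_ext (add_assoc _ _ _)
  zero_add f := hom_ext (zero_add _)
  add_zero f := hom_ext (add_zero _)
  add_comm f g := hom_ext (add_comm _ _)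
  neg_add_cancel f := hom_ext (neg_add_cancel _)
  sub_eq_add_neg f g := hom_ext (sub_eq_add_neg _ _)
  nsmul := nsmulRec
  zsmul := zsmulRec

instance : Preadditive (GrMod 𝒜) where
  add_comp X Y Z f g h := hom_ext (LinearMap.comp_add _ _ _)
  comp_add X Y Z f g h := hom_ext (LinearMap.add_comp _ _ _)

/-- The zero graded module. -/
def zeroObj (𝒜 : ℤ → Submodule k A) : GrMod 𝒜 where
  carrier := PUnit
  deg _ := ⊤
  isInternal := GradedAux.isInternal_of_proj (fun _ => 0) (fun _ _ _ => rfl)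
    (fun _ _ _ _ _ => rfl) (Subsingleton.elim _ _)
  op_smul_mem _ _ := trivial

instance : HasZeroObject (GrMod 𝒜) where
  zero := ⟨zeroObj 𝒜, (IsZero.iff_id_eq_zero _).2 (hom_ext (LinearMap.ext fun _ => rfl))⟩

/-- The direct sum of two graded modules. -/
def prod (X Y : GrMod 𝒜) : GrMod 𝒜 where
  carrier := X × Y
  deg i := (X.deg i).prod (Y.deg i)
  isInternal := GradedAux.isInternal_prod X.isInternal Y.isInternal
  op_smul_mem h ha := ⟨X.op_smul_mem h.1 ha, Y.op_smul_mem h.2 ha⟩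

/-- The biproduct diagram of the direct sum. -/
def prodBicone (X Y : GrMod 𝒜) : BinaryBicone X Y where
  pt := prod X Y
  fst := ⟨LinearMap.fst _ _ _, fun _ _ h => h.1⟩
  snd := ⟨LinearMap.snd _ _ _, fun _ _ h => h.2⟩
  inl := ⟨LinearMap.inl _ _ _, fun _ _ h => ⟨h, Submodule.zero_mem _⟩⟩
  inr := ⟨LinearMap.inr _ _ _, fun _ _ h => ⟨Submodule.zero_mem _, h⟩⟩

instance : HasBinaryBiproducts (GrMod 𝒜) where
  has_binary_biproduct X Y := HasBinaryBiproduct.mk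
    { bicone := prodBicone X Y
      isBilimit := isBinaryBilimitOfTotal _ (hom_ext (LinearMap.coprod_inl_inr ..)) }

instance : HasFiniteBiproducts (GrMod 𝒜) :=
  have : HasFiniteProducts (GrMod 𝒜) := hasFiniteProducts_of_has_binary_and_terminal
  HasFiniteBiproducts.of_hasFiniteProducts

/-- The grading shift `X ↦ X(n)`, with `X(n)ⁱ = Xⁱ⁺ⁿ`. -/
def shift (n : ℤ) : GrMod 𝒜 ⥤ GrMod 𝒜 where
  obj X :=
    { carrier := X
      deg i := X.deg (i + n)
      isInternal := GradedAux.isInternal_shift X.isInternal n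
      op_smul_mem {i j x a} h ha := by
        rw [add_right_comm]
        exact X.op_smul_mem h ha }
  map f := ⟨f.lin, fun i x h => f.map_deg (i + n) x h⟩

/-- The multiplication map `X ⊗ A ⟶ X`, `x ⊗ a ↦ x * a`, with the tensor factors written in the
order `A ⊗ X`. -/
noncomputable def mulMap (X : GrMod 𝒜) : A ⊗[k] X →ₗ[Aᵐᵒᵖ] X :=
  TensorProduct.AlgebraTensorModule.lift
    { toFun := fun a => Algebra.lsmul k k X (op a)
      map_add' := fun a b => by ext; simp
      map_smul' := fun a b => by
        ext x
        simp [mul_smul] }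

theorem mulMap_tmul (X : GrMod 𝒜) (a : A) (x : X) : mulMap X (a ⊗ₜ x) = op a • x := rfl

theorem mulMap_deg (X : GrMod 𝒜) (n : ℤ) :
    ∀ t ∈ GradedAux.tensorDeg 𝒜 X.deg n, mulMap X t ∈ X.deg n := by
  intro t ht
  induction ht using Submodule.span_induction with
  | mem t ht =>
    obtain ⟨i, j, rfl, a, ha, x, hx, rfl⟩ := ht
    rw [mulMap_tmul, add_comm]
    exact X.op_smul_mem hx ha
  | zero =>
    rw [map_zero]
    exact Submodule.zero_mem _
  | add s t _ _ hs ht =>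
    rw [map_add]
    exact Submodule.add_mem _ hs ht
  | smul c t _ ht =>
    rw [LinearMap.map_smul_of_tower]
    exact Submodule.smul_mem _ _ ht

/-- The map `A ⊗ X ⟶ A ⊗ Y` induced by a morphism `X ⟶ Y`. -/
noncomputable def tensorMap {X Y : GrMod 𝒜} (f : X ⟶ Y) : A ⊗[k] X →ₗ[Aᵐᵒᵖ] A ⊗[k] Y :=
  TensorProduct.AlgebraTensorModule.map LinearMap.id (f.lin.restrictScalars k)

theorem mulMap_tensorMap {X Y : GrMod 𝒜} (f : X ⟶ Y) (t : A ⊗[k] X) :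
    mulMap Y (tensorMap f t) = f.lin (mulMap X t) := by
  induction t with
  | zero => simp
  | add s t hs ht => rw [map_add, map_add, map_add, map_add, hs, ht]
  | tmul a x => exact (f.lin.map_smul (op a) x).symm

theorem tensorMap_deg {X Y : GrMod 𝒜} (f : X ⟶ Y) (n : ℤ) :
    ∀ t ∈ GradedAux.tensorDeg 𝒜 X.deg n, tensorMap f t ∈ GradedAux.tensorDeg 𝒜 Y.deg n := by
  intro t ht
  induction ht using Submodule.span_induction with
  | mem t ht =>
    obtain ⟨i, j, h, a, ha, x, hx, rfl⟩ := ht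
    exact Submodule.subset_span ⟨i, j, h, a, ha, f.lin x, f.map_deg j x hx, rfl⟩
  | zero =>
    rw [map_zero]
    exact Submodule.zero_mem _
  | add s t _ _ hs ht =>
    rw [map_add]
    exact Submodule.add_mem _ hs ht
  | smul c t _ ht =>
    rw [LinearMap.map_smul_of_tower]
    exact Submodule.smul_mem _ _ ht

theorem mulMap_surjective (X : GrMod 𝒜) : Function.Surjective (mulMap X) := fun x =>
  ⟨1 ⊗ₜ x, by rw [mulMap_tmul, op_one, one_smul]⟩

/-- A morphism factors through a finitely generated graded projective module. -/
def FactorsThroughProjective {X Y : GrMod 𝒜} (f : X ⟶ Y) : Prop :=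
  ∃ (P : GrMod 𝒜) (g : X ⟶ P) (h : P ⟶ Y), Module.Projective Aᵐᵒᵖ P ∧ g ≫ h = f

theorem FactorsThroughProjective.add {X Y : GrMod 𝒜} {f g : X ⟶ Y}
    (hf : FactorsThroughProjective f) (hg : FactorsThroughProjective g) :
    FactorsThroughProjective (f + g) := by
  obtain ⟨P, a, b, hP, rfl⟩ := hf
  obtain ⟨Q, c, d, hQ, rfl⟩ := hg
  refine ⟨prod P Q, ⟨a.lin.prod c.lin, fun i x h => ⟨a.map_deg i x h, c.map_deg i x h⟩⟩,
    ⟨b.lin.coprod d.lin, fun i x h => Submodule.add_mem _ (b.map_deg i _ h.1) (d.map_deg i _ h.2)⟩,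
    inferInstanceAs (Module.Projective Aᵐᵒᵖ (P × Q)), rfl⟩

theorem FactorsThroughProjective.neg {X Y : GrMod 𝒜} {f : X ⟶ Y}
    (hf : FactorsThroughProjective f) : FactorsThroughProjective (-f) := by
  obtain ⟨P, a, b, hP, rfl⟩ := hf
  exact ⟨P, -a, b, hP, Preadditive.neg_comp _ _⟩

theorem FactorsThroughProjective.zero (X Y : GrMod 𝒜) :
    FactorsThroughProjective (0 : X ⟶ Y) :=
  ⟨zeroObj 𝒜, 0, 0, inferInstanceAs (Module.Projective Aᵐᵒᵖ PUnit.{v + 1}), comp_zero⟩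

theorem FactorsThroughProjective.comp {W X Y Z : GrMod 𝒜} {f : X ⟶ Y}
    (hf : FactorsThroughProjective f) (a : W ⟶ X) (b : Y ⟶ Z) :
    FactorsThroughProjective (a ≫ f ≫ b) := by
  obtain ⟨P, c, d, hP, rfl⟩ := hf
  exact ⟨P, a ≫ c, d ≫ b, hP, by simp only [Category.assoc]⟩

/-- Two morphisms of graded modules are stably equal if their difference factors through a
projective. -/
def stableRel (𝒜 : ℤ → Submodule k A) : HomRel (GrMod 𝒜) :=
  fun _ _ f g => FactorsThroughProjective (f - g)

instance : Congruence (stableRel 𝒜) where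
  equivalence :=
    { refl := fun f => by
        change FactorsThroughProjective (f - f)
        rw [sub_self]
        exact .zero _ _
      symm := fun {f g} h => by
        change FactorsThroughProjective (g - f)
        rw [← neg_sub]
        exact FactorsThroughProjective.neg h
      trans := fun {f g h} h₁ h₂ => by
        change FactorsThroughProjective (f - h)
        rw [← sub_add_sub_cancel f g h]
        exact FactorsThroughProjective.add h₁ h₂ }
  comp_left {X Y Z} f g g' h := by
    change FactorsThroughProjective (f ≫ g - f ≫ g')
    have := FactorsThroughProjective.comp h f (𝟙 _)
    rwa [Category.comp_id, Preadditive.comp_sub] at this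
  comp_right {X Y Z} f f' g h := by
    change FactorsThroughProjective (f ≫ g - f' ≫ g)
    have := FactorsThroughProjective.comp h (𝟙 _) g
    rwa [Category.id_comp, Preadditive.sub_comp] at this

variable [Module.Finite k A] [GradedAlgebra 𝒜]

instance (X : GrMod 𝒜) : Module.Finite k X := Module.Finite.trans Aᵐᵒᵖ X

theorem tensorDeg_smul_mem (X : GrMod 𝒜) {i j : ℤ} {t : A ⊗[k] X} {a : A}
    (ht : t ∈ GradedAux.tensorDeg 𝒜 X.deg i) (ha : a ∈ 𝒜 j) :
    op a • t ∈ GradedAux.tensorDeg 𝒜 X.deg (i + j) := by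
  induction ht using Submodule.span_induction with
  | mem t ht =>
    obtain ⟨p, q, rfl, b, hb, x, hx, rfl⟩ := ht
    rw [TensorProduct.smul_tmul', op_smul_eq_mul]
    exact Submodule.subset_span
      ⟨p + j, q, by ring, b * a, SetLike.GradedMul.mul_mem hb ha, x, hx, rfl⟩
  | zero =>
    rw [smul_zero]
    exact Submodule.zero_mem _
  | add s t _ _ hs ht =>
    rw [smul_add]
    exact Submodule.add_mem _ hs ht
  | smul c t _ ht =>
    rw [smul_comm]
    exact Submodule.smul_mem _ _ ht

/-- The underlying module of `Ω X`, the kernel of the multiplication map `A ⊗ X ⟶ X`. -/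
def OmegaCarrier (X : GrMod 𝒜) : Type v := LinearMap.ker (mulMap X)

noncomputable instance (X : GrMod 𝒜) : AddCommGroup (OmegaCarrier X) :=
  inferInstanceAs (AddCommGroup (LinearMap.ker (mulMap X)))

noncomputable instance (X : GrMod 𝒜) : Module Aᵐᵒᵖ (OmegaCarrier X) :=
  inferInstanceAs (Module Aᵐᵒᵖ (LinearMap.ker (mulMap X)))

noncomputable instance (X : GrMod 𝒜) : Module k (OmegaCarrier X) :=
  inferInstanceAs (Module k (LinearMap.ker (mulMap X)))

instance (X : GrMod 𝒜) : IsScalarTower k Aᵐᵒᵖ (OmegaCarrier X) :=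
  inferInstanceAs (IsScalarTower k Aᵐᵒᵖ (LinearMap.ker (mulMap X)))

/-- The inclusion `Ω X ⟶ A ⊗ X`. -/
noncomputable def omegaIncl (X : GrMod 𝒜) : OmegaCarrier X →ₗ[Aᵐᵒᵖ] A ⊗[k] X :=
  (LinearMap.ker (mulMap X)).subtype

theorem omegaIncl_injective (X : GrMod 𝒜) : Function.Injective (omegaIncl X) :=
  Subtype.val_injective

theorem mulMap_omegaIncl (X : GrMod 𝒜) (t : OmegaCarrier X) : mulMap X (omegaIncl X t) = 0 :=
  t.2

/-- Lifting a map into `A ⊗ X` with values in the kernel to `Ω X`. -/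
noncomputable def omegaLift (X : GrMod 𝒜) {M : Type*} [AddCommGroup M] [Module Aᵐᵒᵖ M]
    (f : M →ₗ[Aᵐᵒᵖ] A ⊗[k] X) (h : ∀ t, mulMap X (f t) = 0) : M →ₗ[Aᵐᵒᵖ] OmegaCarrier X :=
  f.codRestrict (LinearMap.ker (mulMap X)) h

theorem omegaIncl_lift (X : GrMod 𝒜) {M : Type*} [AddCommGroup M] [Module Aᵐᵒᵖ M]
    (f : M →ₗ[Aᵐᵒᵖ] A ⊗[k] X) (h : ∀ t, mulMap X (f t) = 0) (t : M) :
    omegaIncl X (omegaLift X f h t) = f t := rfl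

/-- The degree `n` part of `Ω X`, where `A ⊗ X` is graded by total degree. -/
noncomputable def omegaDeg (X : GrMod 𝒜) (n : ℤ) : Submodule k (OmegaCarrier X) :=
  (GradedAux.tensorDeg 𝒜 X.deg n).comap ((omegaIncl X).restrictScalars k)

theorem omega_isInternal (X : GrMod 𝒜) : DirectSum.IsInternal (omegaDeg X) := by
  have h := GradedAux.isInternal_tensor (DirectSum.Decomposition.isInternal 𝒜) X.isInternal
  refine GradedAux.isInternal_ker h X.isInternal ((mulMap X).restrictScalars k)
    (mulMap_deg X) ((omegaIncl X).restrictScalars k) (omegaIncl_injective X) ?_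
  ext t
  constructor
  · rintro ⟨x, rfl⟩
    exact mulMap_omegaIncl X x
  · intro h
    exact ⟨⟨t, h⟩, rfl⟩

theorem omega_finite (X : GrMod 𝒜) : Module.Finite Aᵐᵒᵖ (OmegaCarrier X) :=
  have : Module.Finite k (OmegaCarrier X) :=
    Module.Finite.of_injective ((omegaIncl X).restrictScalars k) (omegaIncl_injective X)
  Module.Finite.of_restrictScalars_finite k Aᵐᵒᵖ _

theorem omega_smul_mem (X : GrMod 𝒜) {i j : ℤ} {x : OmegaCarrier X} {a : A}
    (h : x ∈ omegaDeg X i) (ha : a ∈ 𝒜 j) : op a • x ∈ omegaDeg X (i + j) := by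
  change omegaIncl X (op a • x) ∈ GradedAux.tensorDeg 𝒜 X.deg (i + j)
  rw [map_smul]
  exact tensorDeg_smul_mem X h ha

/-- The graded module `Ω X = ker (A ⊗ X ⟶ X)`; here `A ⊗ X` is graded by total degree and `A`
acts on it by right multiplication on the factor `A`. Since `0 → I → A ⊗ A → A → 0` splits as a
sequence of left `A`-modules, this is `X ⊗_A I` for `I` the kernel of the multiplication of `A`. -/
noncomputable def omegaObj (X : GrMod 𝒜) : GrMod 𝒜 where
  carrier := OmegaCarrier X
  finite := omega_finite X
  deg := omegaDeg X
  isInternal := omega_isInternal X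
  op_smul_mem := omega_smul_mem X

/-- The linear map `Ω X ⟶ Ω Y` induced by `X ⟶ Y`. -/
noncomputable def omegaLin {X Y : GrMod 𝒜} (f : X ⟶ Y) : OmegaCarrier X →ₗ[Aᵐᵒᵖ] OmegaCarrier Y :=
  omegaLift Y (tensorMap f ∘ₗ omegaIncl X) (fun t => by
    rw [LinearMap.comp_apply, mulMap_tensorMap, mulMap_omegaIncl, map_zero])

theorem omegaIncl_lin {X Y : GrMod 𝒜} (f : X ⟶ Y) (t : OmegaCarrier X) :
    omegaIncl Y (omegaLin f t) = tensorMap f (omegaIncl X t) := rfl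

/-- The morphism `Ω X ⟶ Ω Y` induced by `X ⟶ Y`. -/
noncomputable def omegaMap {X Y : GrMod 𝒜} (f : X ⟶ Y) : omegaObj X ⟶ omegaObj Y where
  lin := omegaLin f
  map_deg n t ht := tensorMap_deg f n (omegaIncl X t) ht

theorem omegaObj_hom_ext {X Y : GrMod 𝒜} {f g : X ⟶ omegaObj Y}
    (h : ∀ t, omegaIncl Y (f.lin t) = omegaIncl Y (g.lin t)) : f = g :=
  hom_ext (LinearMap.ext fun t => omegaIncl_injective Y (h t))

/-- The syzygy functor `Ω` on graded modules, `Ω X = ker (A ⊗ X ⟶ X)`. -/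
noncomputable def omega (𝒜 : ℤ → Submodule k A) [GradedAlgebra 𝒜] : GrMod 𝒜 ⥤ GrMod 𝒜 where
  obj X := omegaObj X
  map f := omegaMap f
  map_id X := omegaObj_hom_ext fun t => by
    exact LinearMap.congr_fun TensorProduct.map_id (omegaIncl X t)
  map_comp {X Y Z} f g := omegaObj_hom_ext fun t => by
    change tensorMap (f ≫ g) (omegaIncl X t) = tensorMap g (tensorMap f (omegaIncl X t))
    induction omegaIncl X t with
    | zero => simp
    | add s t hs ht => rw [map_add, map_add, map_add, hs, ht]
    | tmul a x => rfl

instance : (omega 𝒜).Additive where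
  map_add {X Y f g} := omegaObj_hom_ext fun t => by
    change tensorMap (f + g) (omegaIncl X t) =
      tensorMap f (omegaIncl X t) + tensorMap g (omegaIncl X t)
    induction omegaIncl X t with
    | zero => simp
    | add s t hs ht =>
      rw [map_add, map_add, map_add, hs, ht]
      abel
    | tmul a x => exact TensorProduct.tmul_add _ _ _

theorem omega_projective (P : GrMod 𝒜) (hP : Module.Projective Aᵐᵒᵖ P) :
    Module.Projective Aᵐᵒᵖ ((omega 𝒜).obj P) := by
  obtain ⟨s, hs⟩ := Module.projective_lifting_property (mulMap P) LinearMap.id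
    (mulMap_surjective P)
  have : Module.Projective Aᵐᵒᵖ A := Module.Projective.of_equiv
    ({ toFun := unop
       invFun := op
       map_add' := fun _ _ => rfl
       map_smul' := fun _ _ => rfl
       left_inv := fun _ => rfl
       right_inv := fun _ => rfl } : Aᵐᵒᵖ ≃ₗ[Aᵐᵒᵖ] A)
  have : Module.Projective Aᵐᵒᵖ (A ⊗[k] P) := inferInstance
  have hs' : ∀ x, mulMap P (s x) = x := fun x => LinearMap.congr_fun hs x
  change Module.Projective Aᵐᵒᵖ (OmegaCarrier P)
  refine Module.Projective.of_split (M := A ⊗[k] P) (omegaIncl P)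
    (omegaLift P (LinearMap.id - s ∘ₗ mulMap P) (fun t => by simp [hs'])) ?_
  refine LinearMap.ext fun t => omegaIncl_injective P ?_
  rw [LinearMap.comp_apply, omegaIncl_lift]
  simp [mulMap_omegaIncl]

end GrMod

/-- The graded stable category: finitely generated graded right modules, with morphisms modulo
those that factor through a finitely generated graded projective module. -/
abbrev GrStab (𝒜 : ℤ → Submodule k A) : Type _ := CategoryTheory.Quotient (GrMod.stableRel 𝒜)

namespace GrStab

open GrMod

variable {𝒜 : ℤ → Submodule k A}

theorem stableRel_add ⦃X Y : GrMod 𝒜⦄ (f₁ f₂ g₁ g₂ : X ⟶ Y) (hf : stableRel 𝒜 f₁ f₂)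
    (hg : stableRel 𝒜 g₁ g₂) : stableRel 𝒜 (f₁ + g₁) (f₂ + g₂) := by
  change FactorsThroughProjective (f₁ + g₁ - (f₂ + g₂))
  rw [add_sub_add_comm]
  exact FactorsThroughProjective.add hf hg

instance : Preadditive (GrStab 𝒜) := CategoryTheory.Quotient.preadditive _ stableRel_add

instance : (CategoryTheory.Quotient.functor (stableRel 𝒜)).Additive :=
  CategoryTheory.Quotient.functor_additive _ stableRel_add

variable [Module.Finite k A] [GradedAlgebra 𝒜]

theorem omegaShift_rel (X Y : GrMod 𝒜) (f g : X ⟶ Y) (h : stableRel 𝒜 f g) :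
    (omega 𝒜 ⋙ shift 1 ⋙ CategoryTheory.Quotient.functor (stableRel 𝒜)).map f =
      (omega 𝒜 ⋙ shift 1 ⋙ CategoryTheory.Quotient.functor (stableRel 𝒜)).map g := by
  apply CategoryTheory.Quotient.sound
  obtain ⟨P, a, b, hP, hab⟩ := h
  refine ⟨(shift 1).obj ((omega 𝒜).obj P), (shift 1).map ((omega 𝒜).map a),
    (shift 1).map ((omega 𝒜).map b), omega_projective P hP, ?_⟩
  rw [← Functor.map_comp, ← Functor.map_comp, hab, Functor.map_sub]
  rfl

/-- The endofunctor `Ω(1)` of the graded stable category, induced by `X ↦ (Ω X)(1)`. -/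
noncomputable def omegaShift (𝒜 : ℤ → Submodule k A) [GradedAlgebra 𝒜] : GrStab 𝒜 ⥤ GrStab 𝒜 :=
  CategoryTheory.Quotient.lift _
    (omega 𝒜 ⋙ shift 1 ⋙ CategoryTheory.Quotient.functor (stableRel 𝒜)) omegaShift_rel

instance : (omegaShift 𝒜).Additive where
  map_add {X Y f g} := by
    obtain ⟨f, rfl⟩ := (CategoryTheory.Quotient.functor (stableRel 𝒜)).map_surjective f
    obtain ⟨g, rfl⟩ := (CategoryTheory.Quotient.functor (stableRel 𝒜)).map_surjective g
    change (CategoryTheory.Quotient.functor (stableRel 𝒜)).map ((shift 1).map ((omega 𝒜).map (f + g)))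
      = (CategoryTheory.Quotient.functor (stableRel 𝒜)).map
        ((shift 1).map ((omega 𝒜).map f) + (shift 1).map ((omega 𝒜).map g))
    rw [Functor.map_add]
    rfl

end GrStab
end GradedModules

section KrullSchmidt

theorem hasFiniteBiproducts_of_additive {C : Type*} [Category* C] [Preadditive C]
    {D : Type*} [Category* D] [Preadditive D] (F : C ⥤ D) [F.Additive]
    (hF : Function.Surjective F.obj) [HasFiniteBiproducts C] : HasFiniteBiproducts D where
  out n :=
    { has_biproduct := fun f => by
        choose g hg using fun i => hF (f i)
        obtain rfl : F.obj ∘ g = f := funext hg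
        have : PreservesBiproduct g F := inferInstance
        exact HasBiproduct.mk ⟨F.mapBicone (biproduct.bicone g),
          isBilimitOfPreserves F (biproduct.isBilimit g)⟩ }

/-- An additive category is Krull–Schmidt if every object is isomorphic to a finite direct sum of
objects with local endomorphism rings. -/
def IsKrullSchmidt (C : Type*) [Category* C] [Preadditive C] [HasFiniteBiproducts C] : Prop :=
  ∀ X : C, ∃ (n : ℕ) (Y : Fin n → C),
    (∀ i, IsLocalRing (End (Y i))) ∧ Nonempty (X ≅ ⨁ Y)

instance {k : Type u} {A : Type v} [Field k] [Ring A] [Algebra k A] (𝒜 : ℤ → Submodule k A) :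
    HasFiniteBiproducts (GrStab 𝒜) :=
  hasFiniteBiproducts_of_additive (CategoryTheory.Quotient.functor (GrMod.stableRel 𝒜))
    (fun X => ⟨X.as, rfl⟩)

instance {C : Type u} [Category.{v} C] [Preadditive C] [HasFiniteBiproducts C] (F : C ⥤ C)
    [F.IsEquivalence] [F.Additive] : HasFiniteBiproducts (OrbitCategory F) :=
  hasFiniteBiproducts_of_additive (OrbitCategory.proj F) (fun X => ⟨X.obj, rfl⟩)

instance {C : Type*} [Category* C] [Preadditive C] [HasFiniteBiproducts C] :
    HasBinaryBiproducts C := hasBinaryBiproducts_of_finite_biproducts C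

end KrullSchmidt

/-!
Three facts about `F = Ω(1)` on the graded stable category give the theorem.

*`F` is an equivalence.* Projective modules are injective because `A` is self-injective, and
the degree-preserving part of a linear map transfers extension and lifting properties to graded
modules. Hence maps between syzygies extend along `0 ⟶ Ω X ⟶ X ⊗ A ⟶ X ⟶ 0`, which makes `Ω` full
and faithful modulo projectives. For essential surjectivity each graded module has to embed into a
projective one; by Schanuel's lemma it is then stably the syzygy of the cokernel. The embedding
exists because every simple right `A`-module embeds into `A`
(`SelfInjective.exists_simple_ideal_equiv`): every simple module `T` is related to some simple left
ideal `S` killed on the right by the annihilator of `T`, the isomorphism class of `S` determines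
that of `T`, and only finitely many classes of simple modules embed into the ring, so that this
injective assignment is already surjective on those.

*The stable category is Krull–Schmidt* (`GrStab.induction_on`). By Fitting's lemma a graded module
either splits into two smaller ones or has only nilpotent and invertible endomorphisms, in which
case its stable endomorphism ring is local or zero.

*Morphisms in the orbit category are bounded* (`GrStab.exists_hom_zpow_eq_zero`). As `A` lives in
nonpositive degrees, `F` lowers the top degree of a module, so `Hom(X, Fⁿ Y)` vanishes for large
`n`, and `Hom(X, F⁻ⁿ Y) ≅ Hom(Fⁿ X, Y)` does so too.

The endomorphism ring of an object of the orbit category is therefore a `ℤ`-graded ring with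
finitely many nonzero components. If its component of degree zero is local then so is the whole
ring, and an element is a unit precisely if its component of degree zero is
(`GradedLocal.isUnit_iff`): homogeneous elements of nonzero degree are nilpotent, so products of
two of them of opposite degrees are nonunits in degree zero, and Gaussian elimination inverts the
matrix that describes the multiplication by an element with invertible component of degree zero.
-/

/-! ### Local rings and graded rings -/

namespace IsLocalRing

variable {T : Type*} [Ring T] [IsLocalRing T]

theorem mul_eq_one_symm {a b : T} (h : a * b = 1) : b * a = 1 := by
  have he : (b * a) * (b * a) = b * a := by
    rw [mul_assoc, ← mul_assoc a, h, one_mul]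
  rcases isUnit_or_isUnit_of_add_one (add_sub_cancel (b * a) 1) with hu | hu
  · exact hu.mul_left_cancel (by rw [he, mul_one])
  · exfalso
    have h0 : b * a = 0 := hu.mul_left_cancel (by rw [sub_mul, one_mul, he, sub_self, mul_zero])
    have : (1 : T) = 0 := by
      calc (1 : T) = a * (b * a) * b := by rw [← mul_assoc, h, one_mul, h]
        _ = 0 := by rw [h0, mul_zero, zero_mul]
    exact one_ne_zero this

theorem isUnit_of_isUnit_mul_left {a b : T} (h : IsUnit (a * b)) : IsUnit a := by
  obtain ⟨u, hu⟩ := h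
  have h1 : a * (b * (u⁻¹ : Tˣ)) = 1 := by rw [← mul_assoc, ← hu, Units.mul_inv]
  exact ⟨⟨a, _, h1, mul_eq_one_symm h1⟩, rfl⟩

theorem isUnit_of_isUnit_mul_right {a b : T} (h : IsUnit (a * b)) : IsUnit b := by
  obtain ⟨u, hu⟩ := h
  have h1 : ((u⁻¹ : Tˣ) * a) * b = 1 := by rw [mul_assoc, ← hu, Units.inv_mul]
  exact ⟨⟨b, _, mul_eq_one_symm h1, h1⟩, rfl⟩

theorem mem_ringJacobson_iff_not_isUnit (x : T) : x ∈ Ring.jacobson T ↔ ¬ IsUnit x := by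
  constructor
  · intro hx hu
    exact (Ring.jacobson_lt_top T).ne (Ideal.eq_top_of_isUnit_mem _ hx hu)
  · intro hx
    rw [Ring.jacobson_eq_sInf_isMaximal, Ideal.mem_sInf]
    intro m hm
    by_contra hxm
    obtain ⟨t, a, ha, hta⟩ := Ideal.IsMaximal.exists_inv hm hxm
    rcases isUnit_or_isUnit_of_add_one hta with hu | hu
    · exact hx (isUnit_of_isUnit_mul_right hu)
    · exact hm.ne_top (Ideal.eq_top_of_isUnit_mem _ ha hu)

end IsLocalRing

namespace GradedLocal

/-! Here `R` is a graded ring and `i` embeds the ring `S` as the component of degree zero. -/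

variable {R S : Type*} [Ring R] [Ring S] (𝒱 : ℤ → AddSubgroup R) [GradedRing 𝒱] (i : S →+* R)

/-- Gaussian elimination with homogeneous coefficients: the system `∑ q, a p q * v q = b p` over a
finite set of degrees is solvable as soon as the diagonal entries are units of degree zero and units
of degree zero remain such when a product of two elements of opposite nonzero degrees is
subtracted. -/
theorem exists_solution (hmem : ∀ s, i s ∈ 𝒱 0)
    (hH : ∀ s, IsUnit s → ∀ n ≠ 0, ∀ a ∈ 𝒱 n, ∀ b ∈ 𝒱 (-n), ∃ t, IsUnit t ∧ i t = i s - a * b)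
    (σ : Finset ℤ) : ∀ (a : ℤ → ℤ → R) (b : ℤ → R), (∀ p q, a p q ∈ 𝒱 (p - q)) →
      (∀ p, b p ∈ 𝒱 p) → (∀ p ∈ σ, ∃ s, IsUnit s ∧ i s = a p p) →
      ∃ v : ℤ → R, (∀ p, v p ∈ 𝒱 p) ∧ ∀ p ∈ σ, ∑ q ∈ σ, a p q * v q = b p := by
  classical
  induction σ using Finset.induction_on with
  | empty => exact fun a b _ _ _ => ⟨0, fun p => zero_mem _, by simp⟩
  | insert n σ hn ih =>
    intro a b ha hb hd
    obtain ⟨s, ⟨u, rfl⟩, hs⟩ := hd n (Finset.mem_insert_self _ _)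
    -- Eliminate the unknown of degree `n`, with the pivot `a n n = i u`.
    set w : R := i ((u⁻¹ : Sˣ) : S) with hw
    have haw : a n n * w = 1 := by rw [← hs, hw, ← map_mul, Units.mul_inv, map_one]
    have hwa : w * a n n = 1 := by rw [← hs, hw, ← map_mul, Units.inv_mul, map_one]
    have hw0 : w ∈ 𝒱 0 := hmem _
    have hc : ∀ p, a p n * w ∈ 𝒱 (p - n) := fun p => by
      simpa using SetLike.GradedMul.mul_mem (ha p n) hw0
    obtain ⟨v, hv, hsol⟩ := ih (fun p q => a p q - a p n * w * a n q) (fun p => b p - a p n * w * b n)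
      (fun p q => sub_mem (ha p q) (by
        have := SetLike.GradedMul.mul_mem (hc p) (ha n q)
        rwa [sub_add_sub_cancel] at this))
      (fun p => sub_mem (hb p) (by
        have := SetLike.GradedMul.mul_mem (hc p) (hb n)
        rwa [sub_add_cancel] at this))
      (fun p hp => by
        obtain ⟨s, hs, hs'⟩ := hd p (Finset.mem_insert_of_mem hp)
        obtain ⟨t, ht, ht'⟩ := hH s hs (p - n) (fun h => hn (by
          rw [sub_eq_zero] at h
          exact h ▸ hp)) _ (hc p) (a n p) (by rw [neg_sub]; exact ha n p)
        exact ⟨t, ht, by rw [ht', hs']⟩)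
    set z : R := w * (b n - ∑ q ∈ σ, a n q * v q) with hz
    have hz' : z ∈ 𝒱 n := by
      have h1 : b n - ∑ q ∈ σ, a n q * v q ∈ 𝒱 n := sub_mem (hb n) (sum_mem fun q _ => by
        have := SetLike.GradedMul.mul_mem (ha n q) (hv q)
        rwa [sub_add_cancel] at this)
      simpa using SetLike.GradedMul.mul_mem hw0 h1
    refine ⟨Function.update v n z, fun p => ?_, fun p hp => ?_⟩
    · by_cases hpn : p = n
      · subst hpn
        simpa using hz'
      · simpa [Function.update_of_ne hpn] using hv p
    · have hsum : ∑ q ∈ σ, a p q * Function.update v n z q = ∑ q ∈ σ, a p q * v q :=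
        Finset.sum_congr rfl fun q hq => by
          rw [Function.update_of_ne (by rintro rfl; exact hn hq)]
      rw [Finset.sum_insert hn, Function.update_self, hsum]
      rcases Finset.mem_insert.1 hp with rfl | hp
      · rw [hz, ← mul_assoc, haw, one_mul, sub_add_cancel]
      · have h := hsol p hp
        simp only [sub_mul, Finset.sum_sub_distrib, mul_assoc] at h
        rw [← Finset.mul_sum, ← Finset.mul_sum] at h
        rw [hz, mul_sub, mul_sub, sub_add_eq_add_sub, add_comm, add_sub_assoc]
        rw [sub_eq_sub_iff_add_eq_add] at h
        rw [← add_sub_assoc, sub_eq_iff_eq_add, h]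

section

variable [IsLocalRing S] (hi : Function.Injective i)
  {N : ℕ} (hN : ∀ n : ℤ, (N : ℤ) < |n| → 𝒱 n = ⊥)

include hi hN

/-- A product of degree zero whose first factor is homogeneous of nonzero degree is not a unit in
degree zero, since that factor is nilpotent. -/
theorem not_isUnit_of_opposite {n : ℤ} (hn : n ≠ 0) {a b : R} (ha : a ∈ 𝒱 n) {s : S}
    (hs : i s = a * b) : ¬ IsUnit s := by
  rintro ⟨u, rfl⟩
  have h1 : a * (b * i ((u⁻¹ : Sˣ) : S)) = 1 := by
    rw [← mul_assoc, ← hs, ← map_mul, Units.mul_inv, map_one]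
  set c := b * i ((u⁻¹ : Sˣ) : S)
  have hpow : ∀ m : ℕ, a ^ m * c ^ m = 1 := by
    intro m
    induction m with
    | zero => simp
    | succ m ih => rw [pow_succ, pow_succ', mul_assoc, ← mul_assoc a, h1, one_mul, ih]
  have hmem : a ^ (N + 1) ∈ 𝒱 ((N + 1) • n) := SetLike.pow_mem_graded _ ha
  rw [hN _ (by
    have h1 : 1 ≤ |n| := Int.one_le_abs hn
    rw [nsmul_eq_mul, abs_mul]
    push_cast
    rw [abs_of_nonneg (by positivity)]
    nlinarith), AddSubgroup.mem_bot] at hmem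
  have h0 := hpow (N + 1)
  rw [hmem, zero_mul] at h0
  have : (i 0 : R) = i 1 := by rw [map_zero, map_one, h0]
  exact zero_ne_one (hi this)

variable (hr : ∀ x, x ∈ 𝒱 0 ↔ ∃ s, i s = x)

include hr

/-- An element whose component of degree zero is a unit has a right inverse. Its components solve
a linear system with matrix `x (p - q)`, where `p` and `q` run over the degrees that can occur. -/
theorem exists_mul_eq_one {x : R} {s : S} (hs : IsUnit s)
    (hx : i s = (DirectSum.decompose 𝒱 x 0 : R)) : ∃ y, x * y = 1 := by
  classical
  have hmem : ∀ s, i s ∈ 𝒱 0 := fun s => (hr _).2 ⟨s, rfl⟩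
  have hzero : ∀ {n : ℤ}, n ∉ Finset.Icc (-(N : ℤ)) N → 𝒱 n = ⊥ := fun {n} hn =>
    hN n (by
      by_contra h
      rw [not_lt, abs_le] at h
      exact hn (Finset.mem_Icc.2 h))
  obtain ⟨v, hv, hsol⟩ := exists_solution 𝒱 i hmem (fun s hs n hn a ha b hb => by
      have hab : a * b ∈ 𝒱 0 := by simpa using SetLike.GradedMul.mul_mem ha hb
      obtain ⟨t, ht⟩ := (hr _).1 hab
      refine ⟨s - t, ?_, by rw [map_sub, ht]⟩
      rcases IsLocalRing.isUnit_or_isUnit_of_isUnit_add (a := s - t) (b := t)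
        (by rwa [sub_add_cancel]) with h | h
      · exact h
      · exact absurd h (not_isUnit_of_opposite 𝒱 i hi hN hn ha ht))
    (Finset.Icc (-(N : ℤ)) N) (fun p q => (DirectSum.decompose 𝒱 x (p - q) : R))
    (fun p => if p = 0 then 1 else 0) (fun p q => SetLike.coe_mem _)
    (fun p => by
      split_ifs with h
      · subst h
        exact SetLike.GradedOne.one_mem
      · exact zero_mem _)
    (fun p _ => ⟨s, hs, by rw [hx, sub_self]⟩)
  refine ⟨∑ q ∈ Finset.Icc (-(N : ℤ)) N, v q, ?_⟩
  have hcomp : ∀ p, ((DirectSum.decompose 𝒱 (x * ∑ q ∈ Finset.Icc (-(N : ℤ)) N, v q) p : 𝒱 p) : R) =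
      ∑ q ∈ Finset.Icc (-(N : ℤ)) N, (DirectSum.decompose 𝒱 x (p - q) : R) * v q := by
    intro p
    rw [Finset.mul_sum, DirectSum.decompose_sum, DFinsupp.finsetSum_apply, AddSubgroup.val_finsetSum]
    refine Finset.sum_congr rfl fun q _ => ?_
    have := DirectSum.coe_decompose_mul_add_of_right_mem 𝒱 (i := p - q) (a := x) (hv q)
    rwa [sub_add_cancel] at this
  apply (DirectSum.decompose 𝒱).injective
  ext p
  by_cases hp : p ∈ Finset.Icc (-(N : ℤ)) N
  · rw [hcomp, hsol p hp]
    split_ifs with h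
    · subst h
      exact (DirectSum.decompose_of_mem_same 𝒱 SetLike.GradedOne.one_mem).symm
    · exact (DirectSum.decompose_of_mem_ne 𝒱 SetLike.GradedOne.one_mem (Ne.symm h)).symm
  · have h1 : ∀ y : 𝒱 p, (y : R) = 0 := fun y =>
      (AddSubgroup.mem_bot).1 ((hzero hp).le y.2)
    rw [h1, h1]

/-- If the component of degree zero of a product is a unit, then so is the product of the components
of degree zero, the other contributions to it being nonunits. -/
theorem isUnit_mul_of_isUnit_decompose_mul {x y : R} {s t r : S} (hx : i s = (DirectSum.decompose 𝒱 x 0 : R))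
    (hy : i t = (DirectSum.decompose 𝒱 y 0 : R))
    (hxy : i r = (DirectSum.decompose 𝒱 (x * y) 0 : R)) (hu : IsUnit r) :
    IsUnit (s * t) := by
  classical
  have hsum : ((DirectSum.decompose 𝒱 (x * y) 0 : 𝒱 0) : R) =
      ∑ q ∈ (DirectSum.decompose 𝒱 y).support,
        (DirectSum.decompose 𝒱 x (0 - q) : R) * (DirectSum.decompose 𝒱 y q : R) := by
    conv_lhs => rw [← DirectSum.sum_support_decompose 𝒱 y]
    rw [Finset.mul_sum, DirectSum.decompose_sum, DFinsupp.finsetSum_apply, AddSubgroup.val_finsetSum]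
    refine Finset.sum_congr rfl fun q _ => ?_
    have := DirectSum.coe_decompose_mul_add_of_right_mem 𝒱 (i := 0 - q) (a := x)
      (SetLike.coe_mem (DirectSum.decompose 𝒱 y q))
    rwa [sub_add_cancel] at this
  have hmem : ∀ q, (DirectSum.decompose 𝒱 x (0 - q) : R) * (DirectSum.decompose 𝒱 y q : R) ∈ 𝒱 0 :=
    fun q => by
      simpa using SetLike.GradedMul.mul_mem (SetLike.coe_mem (DirectSum.decompose 𝒱 x (0 - q)))
        (SetLike.coe_mem (DirectSum.decompose 𝒱 y q))
  choose c hc using fun q => (hr _).1 (hmem q)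
  have hrc : r = ∑ q ∈ (DirectSum.decompose 𝒱 y).support, c q := hi (by
    rw [hxy, hsum, map_sum]
    exact Finset.sum_congr rfl fun q _ => (hc q).symm)
  rw [hrc] at hu
  obtain ⟨q, -, hq⟩ := IsLocalRing.exists_of_isUnit_sum hu
  by_cases h0 : q = 0
  · subst h0
    have : c 0 = s * t := hi (by rw [hc, map_mul, hx, hy, sub_zero])
    rwa [← this]
  · exact absurd hq (not_isUnit_of_opposite 𝒱 i hi hN (n := 0 - q) (by simpa using h0)
      (SetLike.coe_mem _) (hc q))

theorem isUnit_iff {x : R} {s : S} (hx : i s = (DirectSum.decompose 𝒱 x 0 : R)) :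
    IsUnit x ↔ IsUnit s := by
  have h1 : i 1 = (DirectSum.decompose 𝒱 (1 : R) 0 : R) := by
    rw [map_one, DirectSum.decompose_of_mem_same 𝒱 SetLike.GradedOne.one_mem]
  have key : ∀ {x y : R} {s t : S}, i s = (DirectSum.decompose 𝒱 x 0 : R) →
      i t = (DirectSum.decompose 𝒱 y 0 : R) → x * y = 1 → IsUnit (s * t) := by
    intro x y s t hx hy hxy
    exact isUnit_mul_of_isUnit_decompose_mul 𝒱 i hi hN hr hx hy (hxy.symm ▸ h1) isUnit_one
  constructor
  · rintro ⟨u, rfl⟩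
    obtain ⟨t, ht⟩ := (hr _).1 (SetLike.coe_mem (DirectSum.decompose 𝒱 (u⁻¹ : Rˣ).val 0))
    exact IsLocalRing.isUnit_of_isUnit_mul_left (key hx ht u.mul_inv)
  · intro hs
    obtain ⟨y, hy⟩ := exists_mul_eq_one 𝒱 i hi hN hr hs hx
    obtain ⟨t, ht⟩ := (hr _).1 (SetLike.coe_mem (DirectSum.decompose 𝒱 y 0))
    obtain ⟨z, hz⟩ := exists_mul_eq_one 𝒱 i hi hN hr
      (IsLocalRing.isUnit_of_isUnit_mul_right (key hx ht hy)) ht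
    have : x = z := by
      calc x = x * (y * z) := by rw [hz, mul_one]
        _ = z := by rw [← mul_assoc, hy, one_mul]
    exact ⟨⟨x, y, hy, this ▸ hz⟩, rfl⟩

theorem isLocalRing : IsLocalRing R := by
  have : Nontrivial R := hi.nontrivial
  refine IsLocalRing.of_isUnit_or_isUnit_one_sub_self fun x => ?_
  obtain ⟨s, hs⟩ := (hr _).1 (SetLike.coe_mem (DirectSum.decompose 𝒱 x 0))
  have hs' : i (1 - s) = (DirectSum.decompose 𝒱 (1 - x) 0 : R) := by
    rw [map_sub, map_one, hs, DirectSum.decompose_sub, DirectSum.sub_apply, AddSubgroup.coe_sub,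
      DirectSum.decompose_of_mem_same 𝒱 SetLike.GradedOne.one_mem]
  rw [isUnit_iff 𝒱 i hi hN hr hs, isUnit_iff 𝒱 i hi hN hr hs']
  exact IsLocalRing.isUnit_or_isUnit_of_add_one (add_sub_cancel s 1)

theorem mem_jacobson_iff {x : R} {s : S} (hx : i s = (DirectSum.decompose 𝒱 x 0 : R)) :
    x ∈ Ring.jacobson R ↔ s ∈ Ring.jacobson S := by
  have := isLocalRing 𝒱 i hi hN hr
  rw [IsLocalRing.mem_ringJacobson_iff_not_isUnit, IsLocalRing.mem_ringJacobson_iff_not_isUnit,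
    isUnit_iff 𝒱 i hi hN hr hx]

end

end GradedLocal

/-! ### Simple modules over self-injective Artinian rings -/

namespace SelfInjective

universe w

variable {R : Type w} [Ring R]

/-- If the annihilator of the simple module `T` is contained in a maximal left ideal `m`, then
`R ⧸ m` is isomorphic to `T`. -/
theorem nonempty_equiv_of_annihilator_le [IsArtinianRing R] {T : Type*} [AddCommGroup T]
    [Module R T] [IsSimpleModule R T] {m : Ideal R} [hm : m.IsMaximal]
    (h : Module.annihilator R T ≤ m) : Nonempty ((R ⧸ m) ≃ₗ[R] T) := by
  classical
  let K : Finset T → Ideal R := fun s => ⨅ t ∈ s, LinearMap.ker (LinearMap.toSpanSingleton R T t)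
  have hK : ∀ s x, x ∈ K s ↔ ∀ t ∈ s, x • t = 0 := fun s x => by simp [K]
  have hex : ∃ s, K s ≤ m := by
    obtain ⟨I, ⟨s, rfl⟩, hI⟩ := IsArtinian.set_has_minimal (Set.range K) ⟨_, ∅, rfl⟩
    refine ⟨s, le_trans (fun x hx => ?_) h⟩
    rw [Module.mem_annihilator]
    intro t
    have hle : K (insert t s) ≤ K s := fun y hy =>
      (hK _ _).2 fun t' ht' => (hK _ _).1 hy t' (Finset.mem_insert_of_mem ht')
    have heq : K (insert t s) = K s := by
      by_contra hne
      exact hI _ ⟨_, rfl⟩ (lt_of_le_of_ne hle hne)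
    rw [← heq] at hx
    exact (hK _ _).1 hx t (Finset.mem_insert_self _ _)
  -- Dropping elements one by one from a finite set with `K s ≤ m`, the annihilator leaves `m` at
  -- some point.
  have step : ∀ s : Finset T, K s ≤ m → ∃ (L : Ideal R) (t : T), ¬ L ≤ m ∧
      ∀ x ∈ L, x • t = 0 → x ∈ m := by
    intro s
    induction s using Finset.induction_on with
    | empty =>
      intro hs
      exact absurd (hs ((hK ∅ 1).2 (by simp))) ((Ideal.ne_top_iff_one m).1 hm.ne_top)
    | insert t s ht ih =>
      intro hs
      by_cases hs' : K s ≤ m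
      · exact ih hs'
      · refine ⟨K s, t, hs', fun x hx hxt => hs ((hK _ _).2 fun t' ht' => ?_)⟩
        rcases Finset.mem_insert.1 ht' with rfl | ht'
        · exact hxt
        · exact (hK _ _).1 hx t' ht'
  obtain ⟨s, hs⟩ := hex
  obtain ⟨L, t, hL, hLt⟩ := step s hs
  -- Both `T` and `R ⧸ m` are quotients of `L`, and the two kernels agree because they are maximal.
  let f : L →ₗ[R] T := LinearMap.toSpanSingleton R T t ∘ₗ L.subtype
  let g : L →ₗ[R] R ⧸ m := m.mkQ ∘ₗ L.subtype
  have : IsSimpleModule R (R ⧸ m) := isSimpleModule_iff_isCoatom.2 hm.out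
  have hg : g ≠ 0 := fun hg => hL fun x hx =>
    (Submodule.Quotient.mk_eq_zero m).1 (LinearMap.congr_fun hg ⟨x, hx⟩)
  have hfg : LinearMap.ker f ≤ LinearMap.ker g := fun x hx =>
    (Submodule.Quotient.mk_eq_zero m).2 (hLt x x.2 hx)
  have hf : f ≠ 0 := fun hf => hg (by
    rw [← LinearMap.ker_eq_top, ← top_le_iff]
    refine le_trans ?_ hfg
    rw [hf, LinearMap.ker_zero])
  have hfs := LinearMap.surjective_of_ne_zero hf
  have hgs := LinearMap.surjective_of_ne_zero hg
  have e := f.quotKerEquivOfSurjective hfs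
  have hco : IsCoatom (LinearMap.ker f) := isSimpleModule_iff_isCoatom.1 (IsSimpleModule.congr e)
  have hne : LinearMap.ker g ≠ ⊤ := fun h => hg (LinearMap.ker_eq_top.1 h)
  have hker : LinearMap.ker f = LinearMap.ker g := ((hco.le_iff.1 hfg).resolve_left hne).symm
  exact ⟨(g.quotKerEquivOfSurjective hgs).symm.trans
    ((Submodule.quotEquivOfEq _ _ hker.symm).trans e)⟩

variable (hinj : Module.Injective R R)

include hinj

/-- The annihilator of a nonzero module `T` has a nonzero left annihilator, hence kills some simple
left ideal from the right. Otherwise right multiplication by generators of `Module.annihilator R T` would embed `R` into a free module, and a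
retraction of this embedding would express `1` by these generators. -/
theorem exists_simple_mul_annihilator_eq_zero [IsArtinianRing R] [IsNoetherianRing Rᵐᵒᵖ]
    (T : Type*) [AddCommGroup T] [Module R T] [Nontrivial T] :
    ∃ S : Ideal R, IsSimpleModule R S ∧ ∀ s ∈ S, ∀ a ∈ Module.annihilator R T, s * a = 0 := by
  classical
  let Z : Ideal R :=
    { carrier := {x | ∀ a ∈ Module.annihilator R T, x * a = 0}
      add_mem' := fun hx hy a ha => by rw [add_mul, hx a ha, hy a ha, add_zero]
      zero_mem' := fun a _ => zero_mul a
      smul_mem' := fun c x hx a ha => by rw [smul_eq_mul, mul_assoc, hx a ha, mul_zero] }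
  have hZ : Z ≠ ⊥ := by
    intro hZ
    let I : Submodule Rᵐᵒᵖ R :=
      { carrier := Module.annihilator R T
        add_mem' := fun hx hy => add_mem hx hy
        zero_mem' := zero_mem _
        smul_mem' := fun c x hx => by
          change x * c.unop ∈ Module.annihilator R T
          replace hx : x ∈ Module.annihilator R T := hx
          rw [Module.mem_annihilator] at hx ⊢
          intro t
          rw [mul_smul, hx] }
    have : IsNoetherian Rᵐᵒᵖ R := isNoetherian_of_linearEquiv
      (MulOpposite.opLinearEquiv Rᵐᵒᵖ (M := R)).symm
    obtain ⟨s, hs⟩ : I.FG := IsNoetherian.noetherian I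
    let φ : R →ₗ[R] (s → R) := LinearMap.pi fun a => LinearMap.toSpanSingleton R R (a : R)
    have hφ : Function.Injective φ := by
      rw [← LinearMap.ker_eq_bot, eq_bot_iff, ← hZ]
      intro x hx a ha
      replace ha : a ∈ Submodule.span Rᵐᵒᵖ (s : Set R) := hs ▸ ha
      induction ha using Submodule.span_induction with
      | mem a ha => exact congrFun hx ⟨a, ha⟩
      | zero => exact mul_zero x
      | add a b ha hb iha ihb =>
        rw [mul_add, iha, ihb, add_zero]
      | smul c a ha iha =>
        change x * (a * c.unop) = 0
        rw [← mul_assoc, iha, zero_mul]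
    obtain ⟨ψ, hψ⟩ := hinj.out φ hφ LinearMap.id
    have h1 : (1 : R) = ∑ a : s, (a : R) * ψ (Pi.single a 1) := by
      calc (1 : R) = ψ (φ 1) := (hψ 1).symm
        _ = ψ (∑ a : s, (a : R) • Pi.single a 1) := by
          congr 1
          ext b
          simp [φ, Finset.sum_apply, Pi.single_apply]
        _ = _ := by simp [map_sum]
    have h1I : (1 : R) ∈ I := by
      rw [h1]
      exact sum_mem fun a _ => I.smul_mem (MulOpposite.op (ψ (Pi.single a 1)))
        (hs ▸ Submodule.subset_span a.2)
    obtain ⟨t, ht⟩ := exists_ne (0 : T)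
    exact ht (by simpa using Module.mem_annihilator.1 h1I t)
  obtain ⟨S, hS, hSZ⟩ := (eq_bot_or_exists_atom_le Z).resolve_left hZ
  exact ⟨S, isSimpleModule_iff_isAtom.2 hS, fun s hs => hSZ hs⟩

/-- The isomorphism class of `S₁` determines that of `T₁`: an isomorphism `S₁ ≃ S₂` is a right
multiplication, so that `S₂` is killed by both annihilators, which therefore lie in a common
maximal left ideal. -/
theorem nonempty_equiv_of_mul_annihilator_eq_zero [IsArtinianRing R]
    {T₁ T₂ : Type*} [AddCommGroup T₁] [Module R T₁] [IsSimpleModule R T₁]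
    [AddCommGroup T₂] [Module R T₂] [IsSimpleModule R T₂] {S₁ S₂ : Ideal R}
    [IsSimpleModule R S₁]
    (h₁ : ∀ s ∈ S₁, ∀ a ∈ Module.annihilator R T₁, s * a = 0)
    (h₂ : ∀ s ∈ S₂, ∀ a ∈ Module.annihilator R T₂, s * a = 0)
    (e : S₁ ≃ₗ[R] S₂) : Nonempty (T₁ ≃ₗ[R] T₂) := by
  obtain ⟨ψ, hψ⟩ := hinj.out S₁.subtype S₁.subtype_injective (S₂.subtype ∘ₗ e.toLinearMap)
  have hne : Module.annihilator R T₁ ⊔ Module.annihilator R T₂ ≠ ⊤ := by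
    intro htop
    have h1 : (1 : R) ∈ Module.annihilator R T₁ ⊔ Module.annihilator R T₂ :=
      htop ▸ Submodule.mem_top
    obtain ⟨a, ha, b, hb, hab⟩ := Submodule.mem_sup.1 h1
    have := IsSimpleModule.nontrivial R S₁
    obtain ⟨s, hs⟩ := exists_ne (0 : S₁)
    have hes : ((e s : S₂) : R) = (s : R) * ψ 1 := by
      have := hψ s
      rw [← mul_one (S₁.subtype s), ← smul_eq_mul, map_smul] at this
      exact this.symm
    have hza : ((e s : S₂) : R) * a = 0 := by
      rw [hes, mul_assoc]
      refine h₁ s s.2 _ ?_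
      exact Ideal.mul_mem_left _ _ ha
    have hzb : ((e s : S₂) : R) * b = 0 := h₂ _ (e s).2 _ hb
    have : ((e s : S₂) : R) = 0 := by
      rw [← mul_one ((e s : S₂) : R), ← hab, mul_add, hza, hzb, add_zero]
    exact hs (e.map_eq_zero_iff.1 (Subtype.ext this))
  obtain ⟨m, hm, hle⟩ := Ideal.exists_le_maximal _ hne
  obtain ⟨e₁⟩ := nonempty_equiv_of_annihilator_le (T := T₁) (le_sup_left.trans hle)
  obtain ⟨e₂⟩ := nonempty_equiv_of_annihilator_le (T := T₂) (le_sup_right.trans hle)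
  exact ⟨e₁.symm.trans e₂⟩

/-- Over a self-injective ring that is Artinian on the left and Noetherian on the right, every
simple module is isomorphic to a left ideal. The left ideals annihilated by `Module.annihilator R T`
define an injective map from the isomorphism classes of simple modules `T` to those that embed into
`R`. The latter correspond to the isotypic components of `R` and are finite in number, so that the
restriction of the map to them is onto. -/
theorem exists_simple_ideal_equiv [IsArtinianRing R] [IsNoetherianRing Rᵐᵒᵖ]
    (T : Type*) [AddCommGroup T] [Module R T] [IsSimpleModule R T] :
    ∃ S : Ideal R, Nonempty (T ≃ₗ[R] S) := by
  have key : ∀ c : isotypicComponents R R, ∃ U S : Ideal R, IsSimpleModule R U ∧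
      IsSimpleModule R S ∧ c = isotypicComponent R R U ∧
      ∀ s ∈ S, ∀ a ∈ Module.annihilator R U, s * a = 0 := by
    rintro ⟨c, U, hU, rfl⟩
    have := IsSimpleModule.nontrivial R U
    obtain ⟨S, hS, hSU⟩ := exists_simple_mul_annihilator_eq_zero hinj U
    exact ⟨U, S, hU, hS, rfl, hSU⟩
  choose U S hU hS hc hSU using key
  let φ : isotypicComponents R R → isotypicComponents R R := fun c =>
    ⟨isotypicComponent R R (S c), S c, hS c, rfl⟩
  have hiso : ∀ {S S' : Ideal R}, IsSimpleModule R S → IsSimpleModule R S' →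
      isotypicComponent R R S = isotypicComponent R R S' → Nonempty (S ≃ₗ[R] S') := by
    intro S S' hS hS' h
    have h1 : IsIsotypicOfType R (isotypicComponent R R S') S' :=
      IsIsotypicOfType.isotypicComponent R R S'
    exact isIsotypicOfType_submodule_iff.1 h1 S (h ▸ S.le_isotypicComponent)
  have hφ : Function.Injective φ := by
    intro c d hcd
    obtain ⟨e⟩ := hiso (hS c) (hS d) (congrArg Subtype.val hcd)
    have := hU c
    have := hU d
    have := hS c
    obtain ⟨e'⟩ := nonempty_equiv_of_mul_annihilator_eq_zero hinj (hSU c) (hSU d) e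
    exact Subtype.ext ((hc c).trans (e'.isotypicComponent_eq.trans (hc d).symm))
  have hsurj := Finite.injective_iff_surjective.1 hφ
  have := IsSimpleModule.nontrivial R T
  obtain ⟨S', hS', hS'T⟩ := exists_simple_mul_annihilator_eq_zero hinj T
  obtain ⟨c, hcS⟩ := hsurj ⟨isotypicComponent R R S', S', hS', rfl⟩
  obtain ⟨e⟩ := hiso (hS c) hS' (congrArg Subtype.val hcS)
  have := hU c
  have := hS c
  obtain ⟨e'⟩ := nonempty_equiv_of_mul_annihilator_eq_zero hinj (hSU c) hS'T e
  exact ⟨U c, ⟨e'.symm⟩⟩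

/-- Over such a ring, the linear forms on a module separate its points. -/
theorem exists_linearMap_ne_zero [IsArtinianRing R] [IsNoetherianRing Rᵐᵒᵖ]
    {M : Type w} [AddCommGroup M] [Module R M] {y : M} (hy : y ≠ 0) :
    ∃ f : M →ₗ[R] R, f y ≠ 0 := by
  let g := LinearMap.toSpanSingleton R M y
  have hne : LinearMap.ker g ≠ ⊤ := fun h => hy (by
    have : (1 : R) ∈ LinearMap.ker g := h ▸ Submodule.mem_top
    simpa [g] using this)
  obtain ⟨m, hm, hle⟩ := Ideal.exists_le_maximal _ hne
  have : IsSimpleModule R (R ⧸ m) := isSimpleModule_iff_isCoatom.2 hm.out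
  obtain ⟨S, ⟨e⟩⟩ := exists_simple_ideal_equiv hinj (R ⧸ m)
  let h : (R ⧸ LinearMap.ker g) →ₗ[R] R :=
    S.subtype ∘ₗ e.toLinearMap ∘ₗ (LinearMap.ker g).liftQ m.mkQ (by simpa using hle)
  obtain ⟨ψ, hψ⟩ := hinj.out ((LinearMap.ker g).liftQ g le_rfl)
    (LinearMap.ker_eq_bot.1 (Submodule.ker_liftQ_eq_bot' _ _ rfl)) h
  refine ⟨ψ, fun h0 => ?_⟩
  have h1 := hψ (Submodule.Quotient.mk 1)
  have h2 : (LinearMap.ker g).liftQ g le_rfl (Submodule.Quotient.mk 1) = y := by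
    simp [g]
  rw [h2, h0] at h1
  have h3 : e (Submodule.Quotient.mk 1) = 0 := Subtype.ext h1.symm
  rw [e.map_eq_zero_iff, Submodule.Quotient.mk_eq_zero] at h3
  exact (Ideal.ne_top_iff_one m).1 hm.ne_top h3

end SelfInjective

/-! ### Graded modules -/

namespace GrMod

open DirectSum TensorProduct MulOpposite

variable {k : Type u} {A : Type v} [Field k] [Ring A] [Algebra k A] {𝒜 : ℤ → Submodule k A}

/-- The projection of a graded module onto its component of degree `n`, viewed as an endomorphism of
the whole module. -/
noncomputable def component (X : GrMod 𝒜) (n : ℤ) : X →ₗ[k] X :=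
  (GradedAux.exists_proj X.isInternal).choose n

section Component

variable (X : GrMod 𝒜)

theorem component_mem (n : ℤ) (x : X) : X.component n x ∈ X.deg n :=
  (GradedAux.exists_proj X.isInternal).choose_spec.1 n x

theorem component_of_mem {n : ℤ} {x : X} (hx : x ∈ X.deg n) : X.component n x = x :=
  (GradedAux.exists_proj X.isInternal).choose_spec.2.1 n x hx

theorem component_of_mem_ne {m n : ℤ} (h : m ≠ n) {x : X} (hx : x ∈ X.deg n) :
    X.component m x = 0 :=
  (GradedAux.exists_proj X.isInternal).choose_spec.2.2.1 m n h x hx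

theorem exists_sum_component (x : X) : ∃ s : Finset ℤ, ∑ n ∈ s, X.component n x = x :=
  (GradedAux.exists_proj X.isInternal).choose_spec.2.2.2 x

theorem exists_component_ne_zero {x : X} (hx : x ≠ 0) : ∃ n, X.component n x ≠ 0 := by
  by_contra! h
  obtain ⟨s, hs⟩ := X.exists_sum_component x
  exact hx (by rw [← hs, Finset.sum_eq_zero fun n _ => h n])

variable {X}

theorem addHom_ext {N : Type*} [AddCommGroup N] {f g : X →+ N}
    (h : ∀ n, ∀ x ∈ X.deg n, f x = g x) : f = g := by
  ext x
  obtain ⟨s, hs⟩ := X.exists_sum_component x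
  rw [← hs, map_sum, map_sum]
  exact Finset.sum_congr rfl fun n _ => h n _ (X.component_mem n x)

theorem hom_ext_deg {Y : GrMod 𝒜} {f g : X ⟶ Y} (h : ∀ n, ∀ x ∈ X.deg n, f.lin x = g.lin x) :
    f = g :=
  hom_ext (LinearMap.ext fun x =>
    DFunLike.congr_fun (addHom_ext (f := f.lin.toAddMonoidHom) (g := g.lin.toAddMonoidHom) h) x)

theorem map_component {Y : GrMod 𝒜} (f : X ⟶ Y) (n : ℤ) (x : X) :
    f.lin (X.component n x) = Y.component n (f.lin x) := by
  refine DFunLike.congr_fun (addHom_ext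
    (f := f.lin.toAddMonoidHom.comp (X.component n).toAddMonoidHom)
    (g := (Y.component n).toAddMonoidHom.comp f.lin.toAddMonoidHom) fun m x hx => ?_) x
  change f.lin (X.component n x) = Y.component n (f.lin x)
  by_cases h : n = m
  · subst h
    rw [component_of_mem _ hx, component_of_mem _ (f.map_deg _ _ hx)]
  · rw [component_of_mem_ne _ h hx, component_of_mem_ne _ h (f.map_deg _ _ hx), map_zero]

theorem component_op_smul {a : A} {j : ℤ} (ha : a ∈ 𝒜 j) (n : ℤ) (x : X) :
    X.component (n + j) (op a • x) = op a • X.component n x := by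
  refine DFunLike.congr_fun (addHom_ext
    (f := (X.component (n + j)).toAddMonoidHom.comp (DistribSMul.toAddMonoidHom X (op a)))
    (g := (DistribSMul.toAddMonoidHom X (op a)).comp (X.component n).toAddMonoidHom)
    fun m x hx => ?_) x
  change X.component (n + j) (op a • x) = op a • X.component n x
  by_cases h : n = m
  · subst h
    rw [component_of_mem _ hx, component_of_mem _ (X.op_smul_mem hx ha)]
  · rw [component_of_mem_ne _ h hx, component_of_mem_ne _ (by omega) (X.op_smul_mem hx ha),
      smul_zero]

theorem component_shift (d n : ℤ) (x : X) :
    ((shift d).obj X).component n x = X.component (n + d) x := by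
  refine DFunLike.congr_fun (addHom_ext (X := (shift d).obj X)
    (f := (((shift d).obj X).component n).toAddMonoidHom)
    (g := (X.component (n + d)).toAddMonoidHom) fun m x hx => ?_) x
  change ((shift d).obj X).component n x = X.component (n + d) x
  by_cases h : n = m
  · subst h
    rw [component_of_mem _ hx, component_of_mem X hx]
  · rw [component_of_mem_ne _ h hx]
    exact (component_of_mem_ne X (m := n + d) (n := m + d) (by omega) hx).symm

theorem mem_deg_of_injective {Y : GrMod 𝒜} {f : X ⟶ Y} (hf : Function.Injective f.lin) {n : ℤ}
    {x : X} (hx : f.lin x ∈ Y.deg n) : x ∈ X.deg n := by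
  have h : X.component n x = x := hf (by rw [map_component, component_of_mem _ hx])
  rw [← h]
  exact X.component_mem n x

theorem exists_mem_deg_of_surjective {Y : GrMod 𝒜} {f : X ⟶ Y} (hf : Function.Surjective f.lin)
    {n : ℤ} {y : Y} (hy : y ∈ Y.deg n) : ∃ x ∈ X.deg n, f.lin x = y := by
  obtain ⟨x, rfl⟩ := hf y
  exact ⟨X.component n x, X.component_mem n x, by rw [map_component, component_of_mem _ hy]⟩

end Component

/-! ### Factorizations of graded maps -/

/-- A graded map with image in the image of an injective graded map factors through it. -/
theorem exists_factor_of_injective {K M Z : GrMod 𝒜} {i : K ⟶ M} (hi : Function.Injective i.lin)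
    (g : Z ⟶ M) (h : ∀ z, ∃ x, i.lin x = g.lin z) : ∃ g' : Z ⟶ K, g' ≫ i = g := by
  let g' : Z →ₗ[Aᵐᵒᵖ] K := (LinearEquiv.ofInjective i.lin hi).symm.toLinearMap ∘ₗ
    g.lin.codRestrict (LinearMap.range i.lin) h
  have hg' : ∀ z, i.lin (g' z) = g.lin z := fun z =>
    congrArg Subtype.val ((LinearEquiv.ofInjective i.lin hi).apply_symm_apply ⟨g.lin z, h z⟩)
  exact ⟨⟨g', fun n z hz => mem_deg_of_injective hi (by rw [hg']; exact g.map_deg n z hz)⟩,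
    hom_ext (LinearMap.ext hg')⟩

/-- A graded map that vanishes on the kernel of a surjective graded map factors through it. -/
theorem exists_factor_of_surjective {M N Z : GrMod 𝒜} {p : M ⟶ N}
    (hp : Function.Surjective p.lin) (f : M ⟶ Z) (h : ∀ m, p.lin m = 0 → f.lin m = 0) :
    ∃ f' : N ⟶ Z, p ≫ f' = f := by
  let f' : N →ₗ[Aᵐᵒᵖ] Z := (LinearMap.ker p.lin).liftQ f.lin h ∘ₗ
    (p.lin.quotKerEquivOfSurjective hp).symm.toLinearMap
  have hf' : ∀ m, f' (p.lin m) = f.lin m := fun m => by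
    have : (p.lin.quotKerEquivOfSurjective hp).symm (p.lin m) = Submodule.Quotient.mk m := by
      rw [LinearEquiv.symm_apply_eq]
      rfl
    simp only [f', LinearMap.comp_apply, LinearEquiv.coe_coe]
    rw [this]
    rfl
  refine ⟨⟨f', fun n y hy => ?_⟩, hom_ext (LinearMap.ext hf')⟩
  obtain ⟨x, hx, rfl⟩ := exists_mem_deg_of_surjective hp hy
  rw [hf']
  exact f.map_deg n x hx

/-- A bijective graded map is an isomorphism. -/
theorem isIso_of_bijective {X Y : GrMod 𝒜} (f : X ⟶ Y) (hf : Function.Bijective f.lin) :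
    IsIso f := by
  obtain ⟨g, hg⟩ := exists_factor_of_injective hf.1 (𝟙 Y) fun y => hf.2 y
  have hg' : ∀ y, f.lin (g.lin y) = y := fun y => LinearMap.congr_fun (congrArg Hom.lin hg) y
  exact ⟨g, hom_ext (LinearMap.ext fun x => hf.1 (hg' (f.lin x))), hg⟩

section Homogenize

variable [Module.Finite k A] [GradedAlgebra 𝒜]

theorem exists_finset_deg_eq_bot (X : GrMod 𝒜) : ∃ s : Finset ℤ, ∀ n ∉ s, X.deg n = ⊥ := by
  have h := X.isInternal.submodule_iSupIndep
  have hfin : {n | X.deg n ≠ ⊥}.Finite := WellFoundedGT.finite_ne_bot_of_iSupIndep h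
  exact ⟨hfin.toFinset, fun n hn => by simpa using hn⟩

/-- The degree-preserving part of a linear map between graded modules. -/
theorem exists_homogenize {X Y : GrMod 𝒜} (φ : X →ₗ[Aᵐᵒᵖ] Y) :
    ∃ f : X ⟶ Y, ∀ n, ∀ x ∈ X.deg n, f.lin x = Y.component n (φ x) := by
  obtain ⟨s, hs⟩ := X.exists_finset_deg_eq_bot
  let ψ : X →+ Y := ∑ n ∈ s, (Y.component n).toAddMonoidHom.comp
    (φ.toAddMonoidHom.comp (X.component n).toAddMonoidHom)
  have hψ : ∀ n, ∀ x ∈ X.deg n, ψ x = Y.component n (φ x) := by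
    intro n x hx
    have h1 : ψ x = ∑ m ∈ s, Y.component m (φ (X.component m x)) := by
      simp [ψ, AddMonoidHom.finsetSum_apply]
    rw [h1]
    by_cases hn : n ∈ s
    · rw [Finset.sum_eq_single_of_mem n hn fun m _ hm => by
        rw [component_of_mem_ne _ hm hx, map_zero, map_zero], component_of_mem _ hx]
    · have hx0 : x = 0 := by
        rwa [hs n hn, Submodule.mem_bot] at hx
      subst hx0
      simp
  have hsmul : ∀ (a : A) (x : X), ψ (op a • x) = op a • ψ x := by
    intro a
    induction a using DirectSum.Decomposition.inductionOn 𝒜 with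
    | zero => simp
    | @homogeneous j a =>
      intro x
      refine DFunLike.congr_fun (addHom_ext
        (f := ψ.comp (DistribSMul.toAddMonoidHom X (op (a : A))))
        (g := (DistribSMul.toAddMonoidHom Y (op (a : A))).comp ψ) fun n x hx => ?_) x
      change ψ (op (a : A) • x) = op (a : A) • ψ x
      rw [hψ _ _ (X.op_smul_mem hx a.2), hψ n x hx, map_smul, component_op_smul a.2]
    | add a b ha hb =>
      intro x
      rw [MulOpposite.op_add, add_smul, map_add, ha, hb, add_smul]
  exact ⟨⟨{ toFun := ψ, map_add' := map_add ψ, map_smul' := fun c x => hsmul c.unop x },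
    fun n x hx => by
      change ψ x ∈ _
      rw [hψ n x hx]
      exact Y.component_mem n _⟩, hψ⟩

/-- Graded modules that are projective as modules have the lifting property for graded maps. -/
theorem exists_lift {P X Y : GrMod 𝒜} (hP : Module.Projective Aᵐᵒᵖ P) {e : X ⟶ Y}
    (he : Function.Surjective e.lin) (f : P ⟶ Y) : ∃ g : P ⟶ X, g ≫ e = f := by
  obtain ⟨φ, hφ⟩ := Module.projective_lifting_property e.lin f.lin he
  obtain ⟨g, hg⟩ := exists_homogenize φ
  refine ⟨g, hom_ext_deg fun n x hx => ?_⟩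
  change e.lin (g.lin x) = f.lin x
  rw [hg n x hx, map_component, ← LinearMap.comp_apply, hφ, ← map_component, component_of_mem _ hx]

theorem injective_op (hinj : Module.Injective Aᵐᵒᵖ A) : Module.Injective Aᵐᵒᵖ Aᵐᵒᵖ := by
  let e : A ≃ₗ[Aᵐᵒᵖ] Aᵐᵒᵖ :=
    { toFun := op
      invFun := unop
      map_add' := fun _ _ => rfl
      map_smul' := fun _ _ => rfl
      left_inv := fun _ => rfl
      right_inv := fun _ => rfl }
  refine ⟨fun X Y _ _ _ _ f hf g => ?_⟩
  obtain ⟨h, hh⟩ := hinj.out f hf (e.symm.toLinearMap ∘ₗ g)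
  exact ⟨e.toLinearMap ∘ₗ h, fun x => congrArg e (hh x)⟩

/-- Over a self-injective algebra, graded modules that are projective as modules have the
extension property for graded maps. -/
theorem exists_extension (hinj : Module.Injective Aᵐᵒᵖ A) {P X Y : GrMod 𝒜}
    (hP : Module.Projective Aᵐᵒᵖ P) {i : X ⟶ Y} (hi : Function.Injective i.lin) (f : X ⟶ P) :
    ∃ g : Y ⟶ P, i ≫ g = f := by
  obtain ⟨n, r, hr⟩ := Module.Finite.exists_fin' Aᵐᵒᵖ P
  obtain ⟨s, hs⟩ := Module.projective_lifting_property r LinearMap.id hr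
  have hop := injective_op hinj
  choose c hc using fun j : Fin n =>
    hop.out i.lin hi (LinearMap.proj j ∘ₗ s ∘ₗ f.lin)
  have hφ : ∀ x, r (LinearMap.pi c (i.lin x)) = f.lin x := fun x => by
    have h1 : LinearMap.pi c (i.lin x) = s (f.lin x) := funext fun j => hc j x
    rw [h1]
    exact LinearMap.congr_fun hs _
  obtain ⟨g, hg⟩ := exists_homogenize (r ∘ₗ LinearMap.pi c)
  refine ⟨g, hom_ext_deg fun m x hx => ?_⟩
  change g.lin (i.lin x) = f.lin x
  rw [hg m _ (i.map_deg m x hx), LinearMap.comp_apply, hφ, ← map_component, component_of_mem _ hx]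

end Homogenize

/-! ### Subobjects, quotients and free objects -/

section Objects

variable [Module.Finite k A]

instance (X : GrMod 𝒜) (N : Submodule Aᵐᵒᵖ X) : Module.Finite Aᵐᵒᵖ N :=
  have : Module.Finite k X := Module.Finite.trans Aᵐᵒᵖ X
  have : Module.Finite k N := Module.Finite.of_injective (N.subtype.restrictScalars k)
    N.subtype_injective
  Module.Finite.of_restrictScalars_finite k Aᵐᵒᵖ _

/-- A submodule closed under taking homogeneous components, as a graded module. -/
noncomputable def subObj (X : GrMod 𝒜) (N : Submodule Aᵐᵒᵖ X)
    (hN : ∀ n, ∀ x ∈ N, X.component n x ∈ N) : GrMod 𝒜 where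
  carrier := N
  deg n := (X.deg n).comap (N.subtype.restrictScalars k)
  isInternal := by
    let p : ℤ → N →ₗ[k] N := fun n =>
      ((X.component n).comp (N.subtype.restrictScalars k)).codRestrict (N.restrictScalars k)
        (fun x => hN n x x.2)
    have hp : ∀ n x, ((p n x : N) : X) = X.component n x := fun _ _ => rfl
    refine GradedAux.isInternal_of_proj p (fun n x hx => Subtype.ext (X.component_of_mem hx))
      (fun m n hmn x hx => Subtype.ext (X.component_of_mem_ne hmn hx))
      (GradedAux.iSup_eq_top_of_sum p (fun n x => X.component_mem n x) fun x => ?_)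
    obtain ⟨s, hs⟩ := X.exists_sum_component x
    refine ⟨s, Subtype.ext ?_⟩
    rw [AddSubmonoidClass.coe_finsetSum, Finset.sum_congr rfl fun n _ => hp n x, hs]
  op_smul_mem h ha := X.op_smul_mem h ha

/-- The quotient of a graded module by a submodule closed under taking homogeneous components. -/
noncomputable def quotObj (X : GrMod 𝒜) (N : Submodule Aᵐᵒᵖ X)
    (hN : ∀ n, ∀ x ∈ N, X.component n x ∈ N) : GrMod 𝒜 where
  carrier := X ⧸ N
  deg n := (X.deg n).map (N.mkQ.restrictScalars k)
  isInternal := by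
    let e := Submodule.Quotient.restrictScalarsEquiv k N
    let p : ℤ → (X ⧸ N) →ₗ[k] (X ⧸ N) := fun n =>
      e.toLinearMap ∘ₗ (N.restrictScalars k).mapQ (N.restrictScalars k) (X.component n)
        (fun x hx => hN n x hx) ∘ₗ e.symm.toLinearMap
    have hp : ∀ n x, p n (N.mkQ x) = N.mkQ (X.component n x) := fun _ _ => rfl
    refine GradedAux.isInternal_of_proj p ?_ ?_ (GradedAux.iSup_eq_top_of_sum p ?_ ?_)
    · rintro n _ ⟨x, hx, rfl⟩
      exact (hp n x).trans (congrArg N.mkQ (X.component_of_mem hx))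
    · rintro m n hmn _ ⟨x, hx, rfl⟩
      exact (hp m x).trans ((congrArg N.mkQ (X.component_of_mem_ne hmn hx)).trans (map_zero _))
    · intro n y
      obtain ⟨x, rfl⟩ := N.mkQ_surjective y
      exact ⟨_, X.component_mem n x, rfl⟩
    · intro y
      obtain ⟨x, rfl⟩ := N.mkQ_surjective y
      obtain ⟨s, hs⟩ := X.exists_sum_component x
      refine ⟨s, ?_⟩
      rw [Finset.sum_congr rfl fun n _ => hp n x, ← map_sum, hs]
  op_smul_mem := by
    rintro i j _ a ⟨x, hx, rfl⟩ ha
    exact ⟨op a • x, X.op_smul_mem hx ha, rfl⟩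

/-- The projection onto a quotient of graded modules. -/
noncomputable def quotObjProj (X : GrMod 𝒜) (N : Submodule Aᵐᵒᵖ X)
    (hN : ∀ n, ∀ x ∈ N, X.component n x ∈ N) : X ⟶ X.quotObj N hN :=
  ⟨N.mkQ, fun _ x h => ⟨x, h, rfl⟩⟩

theorem projective_self : Module.Projective Aᵐᵒᵖ A := Module.Projective.of_equiv
  ({ toFun := unop
     invFun := op
     map_add' := fun _ _ => rfl
     map_smul' := fun _ _ => rfl
     left_inv := fun _ => rfl
     right_inv := fun _ => rfl } : Aᵐᵒᵖ ≃ₗ[Aᵐᵒᵖ] A)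

variable [GradedAlgebra 𝒜]

variable (𝒜) in
/-- The algebra as a graded right module over itself. -/
def regObj : GrMod 𝒜 where
  carrier := A
  finite := Module.Finite.of_restrictScalars_finite k Aᵐᵒᵖ A
  deg := 𝒜
  isInternal := DirectSum.Decomposition.isInternal 𝒜
  op_smul_mem h ha := SetLike.GradedMul.mul_mem h ha

/-- The graded module `X ⊗ A`, graded by total degree, with the tensor factors written in the order
`A ⊗ X`. -/
noncomputable def freeObj (X : GrMod 𝒜) : GrMod 𝒜 where
  carrier := A ⊗[k] X
  finite := Module.Finite.of_restrictScalars_finite k Aᵐᵒᵖ _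
  deg := GradedAux.tensorDeg 𝒜 X.deg
  isInternal := GradedAux.isInternal_tensor (DirectSum.Decomposition.isInternal 𝒜) X.isInternal
  op_smul_mem := tensorDeg_smul_mem X

theorem freeObj_projective (X : GrMod 𝒜) : Module.Projective Aᵐᵒᵖ X.freeObj :=
  have : Module.Projective Aᵐᵒᵖ A := projective_self
  inferInstanceAs (Module.Projective Aᵐᵒᵖ (A ⊗[k] X))

/-- The inclusion `Ω X ⟶ X ⊗ A`. -/
noncomputable def freeIncl (X : GrMod 𝒜) : omegaObj X ⟶ X.freeObj :=
  ⟨omegaIncl X, fun _ _ h => h⟩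

/-- The multiplication `X ⊗ A ⟶ X`. -/
noncomputable def freeMul (X : GrMod 𝒜) : X.freeObj ⟶ X := ⟨mulMap X, mulMap_deg X⟩

/-- The map `X ⊗ A ⟶ Y ⊗ A` induced by a map `X ⟶ Y`. -/
noncomputable def freeMap {X Y : GrMod 𝒜} (f : X ⟶ Y) : X.freeObj ⟶ Y.freeObj :=
  ⟨tensorMap f, tensorMap_deg f⟩

theorem freeIncl_injective (X : GrMod 𝒜) : Function.Injective X.freeIncl.lin :=
  omegaIncl_injective X

theorem freeMul_surjective (X : GrMod 𝒜) : Function.Surjective X.freeMul.lin :=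
  mulMap_surjective X

theorem freeIncl_mul (X : GrMod 𝒜) : X.freeIncl ≫ X.freeMul = 0 :=
  hom_ext (LinearMap.ext (mulMap_omegaIncl X))

theorem freeMap_mul {X Y : GrMod 𝒜} (f : X ⟶ Y) : freeMap f ≫ Y.freeMul = X.freeMul ≫ f :=
  hom_ext (LinearMap.ext (mulMap_tensorMap f))

theorem freeIncl_map {X Y : GrMod 𝒜} (f : X ⟶ Y) :
    X.freeIncl ≫ freeMap f = omegaMap f ≫ Y.freeIncl := rfl

theorem exists_freeIncl_eq (X : GrMod 𝒜) {t : X.freeObj} (h : X.freeMul.lin t = 0) :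
    ∃ x, X.freeIncl.lin x = t := ⟨⟨t, h⟩, rfl⟩

/-- A graded map to `Y ⊗ A` that is killed by the multiplication factors through `Ω Y`. -/
theorem exists_factor_freeIncl {Y Z : GrMod 𝒜} (g : Z ⟶ Y.freeObj) (h : g ≫ Y.freeMul = 0) :
    ∃ g' : Z ⟶ omegaObj Y, g' ≫ Y.freeIncl = g :=
  exists_factor_of_injective Y.freeIncl_injective g fun z =>
    exists_freeIncl_eq Y (LinearMap.congr_fun (congrArg Hom.lin h) z)

/-- A graded map from `X ⊗ A` that vanishes on `Ω X` factors through the multiplication. -/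
theorem exists_factor_freeMul {X Z : GrMod 𝒜} (f : X.freeObj ⟶ Z) (h : X.freeIncl ≫ f = 0) :
    ∃ f' : X ⟶ Z, X.freeMul ≫ f' = f :=
  exists_factor_of_surjective X.freeMul_surjective f fun t ht => by
    obtain ⟨x, rfl⟩ := exists_freeIncl_eq X ht
    exact LinearMap.congr_fun (congrArg Hom.lin h) x

/-- Over a self-injective algebra, a nonzero homogeneous element is detected by a graded map to a
shift of `A`. -/
theorem exists_shift_regObj_ne_zero (hinj : Module.Injective Aᵐᵒᵖ A) {Y : GrMod 𝒜} {m : ℤ} {y : Y}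
    (hy : y ∈ Y.deg m) (hy0 : y ≠ 0) :
    ∃ (d : ℤ) (f : Y ⟶ (shift d).obj (regObj 𝒜)), f.lin y ≠ 0 := by
  have : IsArtinianRing Aᵐᵒᵖ := IsArtinianRing.of_finite k Aᵐᵒᵖ
  have : IsNoetherianRing Aᵐᵒᵖᵐᵒᵖ := IsNoetherianRing.of_finite k Aᵐᵒᵖᵐᵒᵖ
  obtain ⟨f, hf⟩ := SelfInjective.exists_linearMap_ne_zero (injective_op hinj) hy0
  let φ : Y →ₗ[Aᵐᵒᵖ] regObj 𝒜 :=
    { toFun := fun y => (f y).unop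
      map_add' := fun a b => by rw [map_add]; rfl
      map_smul' := fun a b => by rw [map_smul]; rfl }
  have hφ : φ y ≠ 0 := fun h => hf (unop_injective h)
  obtain ⟨n, hn⟩ := exists_component_ne_zero _ hφ
  obtain ⟨g, hg⟩ := exists_homogenize (Y := (shift (n - m)).obj (regObj 𝒜)) φ
  refine ⟨n - m, g, ?_⟩
  rw [hg m y hy]
  have h2 := component_shift (X := regObj 𝒜) (n - m) m (φ y)
  rw [add_sub_cancel] at h2
  exact fun h => hn (h2.symm.trans h)

/-- Over a self-injective algebra, every graded module embeds into a projective one: as long as a map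
to a projective has a nonzero kernel, adding a shift of `A` to the target makes the kernel
smaller. -/
theorem exists_injective_to_projective (hinj : Module.Injective Aᵐᵒᵖ A) (Y : GrMod 𝒜) :
    ∃ (P : GrMod 𝒜) (j : Y ⟶ P), Module.Projective Aᵐᵒᵖ P ∧ Function.Injective j.lin := by
  have key : ∀ (d : ℕ) (P : GrMod 𝒜) (j : Y ⟶ P), Module.Projective Aᵐᵒᵖ P →
      Module.finrank k (LinearMap.ker (j.lin.restrictScalars k)) ≤ d →
      ∃ (P : GrMod 𝒜) (j : Y ⟶ P), Module.Projective Aᵐᵒᵖ P ∧ Function.Injective j.lin := by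
    intro d
    induction d with
    | zero =>
      intro P j hP hd
      refine ⟨P, j, hP, ?_⟩
      have h0 : LinearMap.ker (j.lin.restrictScalars k) = ⊥ :=
        Submodule.finrank_eq_zero.1 (Nat.le_zero.1 hd)
      intro x y hxy
      exact LinearMap.ker_eq_bot.1 h0 hxy
    | succ d ih =>
      intro P j hP hd
      by_cases hj : Function.Injective j.lin
      · exact ⟨P, j, hP, hj⟩
      · obtain ⟨y, hjy, hy0⟩ : ∃ y, j.lin y = 0 ∧ y ≠ 0 := by
          by_contra! h
          exact hj ((injective_iff_map_eq_zero _).2 h)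
        obtain ⟨m, hm⟩ := exists_component_ne_zero _ hy0
        obtain ⟨e, f, hf⟩ := exists_shift_regObj_ne_zero hinj (Y.component_mem m y) hm
        have hjm : j.lin (Y.component m y) = 0 := by rw [map_component, hjy, map_zero]
        have hreg : Module.Projective Aᵐᵒᵖ A := projective_self
        refine ih (prod P ((shift e).obj (regObj 𝒜)))
          ⟨j.lin.prod f.lin, fun i x h => ⟨j.map_deg i x h, f.map_deg i x h⟩⟩
          (inferInstanceAs (Module.Projective Aᵐᵒᵖ (P × A))) ?_
        refine Nat.le_of_lt_succ (lt_of_lt_of_le (Submodule.finrank_lt_finrank_of_lt ?_) hd)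
        refine SetLike.lt_iff_le_and_exists.2 ⟨fun x hx => congrArg Prod.fst hx,
          Y.component m y, hjm, fun h => hf (congrArg Prod.snd h)⟩
  exact key _ (zeroObj 𝒜) 0 (inferInstanceAs (Module.Projective Aᵐᵒᵖ PUnit.{v + 1})) le_rfl

end Objects

end GrMod

/-! ### The syzygy functor on the stable category -/

namespace GrMod

variable {k : Type u} {A : Type v} [Field k] [Ring A] [Algebra k A] {𝒜 : ℤ → Submodule k A}

theorem mono_of_injective {X Y : GrMod 𝒜} {i : X ⟶ Y} (hi : Function.Injective i.lin) : Mono i where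
  right_cancellation _ _ h :=
    hom_ext (LinearMap.ext fun z => hi (LinearMap.congr_fun (congrArg Hom.lin h) z))

theorem shift_map_surjective (n : ℤ) {X Y : GrMod 𝒜} (φ : (shift n).obj X ⟶ (shift n).obj Y) :
    ∃ f : X ⟶ Y, (shift n).map f = φ :=
  ⟨⟨φ.lin, fun i x hx => by
    have h := φ.map_deg (i - n) x
    change x ∈ X.deg (i - n + n) → φ.lin x ∈ Y.deg (i - n + n) at h
    rw [sub_add_cancel] at h
    exact h hx⟩, rfl⟩

theorem FactorsThroughProjective.shift {X Y : GrMod 𝒜} {f : X ⟶ Y}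
    (hf : FactorsThroughProjective f) (n : ℤ) :
    FactorsThroughProjective ((GrMod.shift n).map f) := by
  obtain ⟨P, a, b, hP, rfl⟩ := hf
  exact ⟨(GrMod.shift n).obj P, (GrMod.shift n).map a, (GrMod.shift n).map b, hP, rfl⟩

theorem FactorsThroughProjective.of_shift {X Y : GrMod 𝒜} {f : X ⟶ Y} {n : ℤ}
    (hf : FactorsThroughProjective ((GrMod.shift n).map f)) : FactorsThroughProjective f := by
  obtain ⟨P, a, b, hP, hab⟩ := hf
  refine ⟨(GrMod.shift (-n)).obj P, ⟨a.lin, fun i x hx => ?_⟩, ⟨b.lin, fun i x hx => ?_⟩, hP,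
    hom_ext (congrArg Hom.lin hab :)⟩
  · refine a.map_deg (i + -n) x ?_
    change x ∈ X.deg (i + -n + n)
    rwa [neg_add_cancel_right]
  · have h := b.map_deg (i + -n) x hx
    change b.lin x ∈ Y.deg (i + -n + n) at h
    rwa [neg_add_cancel_right] at h

variable [Module.Finite k A] [GradedAlgebra 𝒜]

/-- The syzygy functor is stably faithful: if `Ω f` factors through the injective module `P`, the
factor `Ω X ⟶ P` extends to `X ⊗ A`, which changes `f ⊗ A` into a map that vanishes on `Ω X` and
provides a factorization of `f` through `Y ⊗ A`. -/
theorem FactorsThroughProjective.of_omegaMap (hinj : Module.Injective Aᵐᵒᵖ A) {X Y : GrMod 𝒜}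
    {f : X ⟶ Y} (hf : FactorsThroughProjective (omegaMap f)) : FactorsThroughProjective f := by
  obtain ⟨P, a, b, hP, hab⟩ := hf
  obtain ⟨c, hc⟩ := exists_extension hinj hP X.freeIncl_injective a
  obtain ⟨s, hs⟩ := exists_factor_freeMul (freeMap f - c ≫ b ≫ Y.freeIncl) (by
    rw [Preadditive.comp_sub, freeIncl_map, reassoc_of% hc, reassoc_of% hab, sub_self])
  refine ⟨Y.freeObj, s, Y.freeMul, Y.freeObj_projective, ?_⟩
  refine hom_ext (LinearMap.ext fun x => ?_)
  obtain ⟨t, rfl⟩ := X.freeMul_surjective x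
  have h : X.freeMul ≫ s ≫ Y.freeMul = X.freeMul ≫ f := by
    rw [reassoc_of% hs, Preadditive.sub_comp, Category.assoc, Category.assoc, freeIncl_mul,
      comp_zero, comp_zero, sub_zero, freeMap_mul]
  exact LinearMap.congr_fun (congrArg Hom.lin h) t

/-- The syzygy functor is stably full: a map `Ω X ⟶ Ω Y` extends to `X ⊗ A ⟶ Y ⊗ A`, and any two
maps `X ⊗ A ⟶ Y ⊗ A` over the same `X ⟶ Y` differ by a map to `Ω Y`. -/
theorem exists_omegaMap_sub (hinj : Module.Injective Aᵐᵒᵖ A) {X Y : GrMod 𝒜}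
    (g : omegaObj X ⟶ omegaObj Y) : ∃ f : X ⟶ Y, FactorsThroughProjective (omegaMap f - g) := by
  have := mono_of_injective Y.freeIncl_injective
  obtain ⟨c, hc⟩ := exists_extension hinj Y.freeObj_projective X.freeIncl_injective
    (g ≫ Y.freeIncl)
  obtain ⟨f, hf⟩ := exists_factor_freeMul (c ≫ Y.freeMul) (by
    rw [reassoc_of% hc, freeIncl_mul, comp_zero])
  obtain ⟨h, hh⟩ := exists_factor_freeIncl (freeMap f - c) (by
    rw [Preadditive.sub_comp, freeMap_mul, hf, sub_self])
  refine ⟨f, X.freeObj, X.freeIncl, h, X.freeObj_projective, ?_⟩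
  rw [← cancel_mono Y.freeIncl, Category.assoc, hh, Preadditive.comp_sub, Preadditive.sub_comp, hc,
    freeIncl_map]

/-- The syzygy functor is stably essentially surjective: `Y` embeds into a projective `P`, and
Schanuel's lemma compares `0 ⟶ Y ⟶ P ⟶ P ⧸ Y ⟶ 0` with the sequence defining `Ω (P ⧸ Y)`. -/
theorem exists_omegaObj_stable_iso (hinj : Module.Injective Aᵐᵒᵖ A) (Y : GrMod 𝒜) :
    ∃ (X : GrMod 𝒜) (a : omegaObj X ⟶ Y) (b : Y ⟶ omegaObj X),
      FactorsThroughProjective (a ≫ b - 𝟙 _) ∧ FactorsThroughProjective (b ≫ a - 𝟙 _) := by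
  obtain ⟨P, j, hP, hj⟩ := exists_injective_to_projective hinj Y
  let N : Submodule _ P := LinearMap.range j.lin
  have hN : ∀ n, ∀ x ∈ N, P.component n x ∈ N := by
    rintro n _ ⟨y, rfl⟩
    exact ⟨Y.component n y, map_component j n y⟩
  let X := P.quotObj N hN
  let p : P ⟶ X := P.quotObjProj N hN
  have hp : Function.Surjective p.lin := N.mkQ_surjective
  have hjp : j ≫ p = 0 := hom_ext (LinearMap.ext fun y =>
    (Submodule.Quotient.mk_eq_zero N).2 ⟨y, rfl⟩)
  have hlift : ∀ {Z : GrMod 𝒜} (g : Z ⟶ P), g ≫ p = 0 → ∃ g', g' ≫ j = g := fun g hg =>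
    exists_factor_of_injective hj g fun z =>
      (Submodule.Quotient.mk_eq_zero N).1 (LinearMap.congr_fun (congrArg Hom.lin hg) z)
  have := mono_of_injective hj
  have := mono_of_injective X.freeIncl_injective
  obtain ⟨α, hα⟩ := exists_lift X.freeObj_projective hp X.freeMul
  obtain ⟨β, hβ⟩ := exists_lift hP X.freeMul_surjective p
  obtain ⟨a, ha⟩ := hlift (X.freeIncl ≫ α) (by rw [Category.assoc, hα, freeIncl_mul])
  obtain ⟨b, hb⟩ := exists_factor_freeIncl (j ≫ β) (by rw [Category.assoc, hβ, hjp])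
  obtain ⟨h, hh⟩ := exists_factor_freeIncl (α ≫ β - 𝟙 _) (by
    rw [Preadditive.sub_comp, Category.assoc, hβ, hα, Category.id_comp, sub_self])
  obtain ⟨h', hh'⟩ := hlift (β ≫ α - 𝟙 _) (by
    rw [Preadditive.sub_comp, Category.assoc, hα, hβ, Category.id_comp, sub_self])
  refine ⟨X, a, b, ⟨X.freeObj, X.freeIncl, h, X.freeObj_projective, ?_⟩, ⟨P, j, h', hP, ?_⟩⟩
  · rw [← cancel_mono X.freeIncl, Category.assoc, hh, Preadditive.sub_comp, Category.assoc, hb,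
      reassoc_of% ha, Preadditive.comp_sub, Category.comp_id, Category.id_comp]
  · rw [← cancel_mono j, Category.assoc, hh', Preadditive.sub_comp, Category.assoc, ha,
      reassoc_of% hb, Preadditive.comp_sub, Category.comp_id, Category.id_comp]

end GrMod

namespace GrStab

open GrMod

variable {k : Type u} {A : Type v} [Field k] [Ring A] [Algebra k A] {𝒜 : ℤ → Submodule k A}

/-- The quotient functor from graded modules to the graded stable category. -/
abbrev quot (𝒜 : ℤ → Submodule k A) : GrMod 𝒜 ⥤ GrStab 𝒜 :=
  CategoryTheory.Quotient.functor (stableRel 𝒜)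

theorem quot_map_eq_iff {X Y : GrMod 𝒜} (f g : X ⟶ Y) :
    (quot 𝒜).map f = (quot 𝒜).map g ↔ FactorsThroughProjective (f - g) :=
  CategoryTheory.Quotient.functor_map_eq_iff _ f g

variable [Module.Finite k A] [GradedAlgebra 𝒜]

theorem omegaShift_isEquivalence (hinj : Module.Injective Aᵐᵒᵖ A) :
    (omegaShift 𝒜).IsEquivalence where
  faithful := ⟨by
    rintro ⟨X⟩ ⟨Y⟩ f g h
    obtain ⟨f, rfl⟩ := (quot 𝒜).map_surjective f
    obtain ⟨g, rfl⟩ := (quot 𝒜).map_surjective g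
    have h := (quot_map_eq_iff ((shift 1).map (omegaMap f)) ((shift 1).map (omegaMap g))).1 h
    rw [quot_map_eq_iff]
    have h' : FactorsThroughProjective ((shift 1).map ((omega 𝒜).map (f - g))) := by
      rw [Functor.map_sub]
      exact h
    exact h'.of_shift.of_omegaMap hinj⟩
  full := ⟨by
    rintro ⟨X⟩ ⟨Y⟩ g
    obtain ⟨g, rfl⟩ := (quot 𝒜).map_surjective g
    obtain ⟨g, rfl⟩ := shift_map_surjective 1 g
    obtain ⟨f, hf⟩ := exists_omegaMap_sub hinj g
    exact ⟨(quot 𝒜).map f, (quot_map_eq_iff _ _).2 (hf.shift 1)⟩⟩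
  essSurj := ⟨by
    rintro ⟨Y⟩
    -- The double shift `Y(-1)(1)` is isomorphic, but not definitionally equal, to `Y`.
    obtain ⟨X, a, b, hab, hba⟩ := exists_omegaObj_stable_iso hinj ((shift (-1)).obj Y)
    let e : (shift 1).obj ((shift (-1)).obj Y) ⟶ Y := ⟨LinearMap.id, fun i x hx => by
      change x ∈ Y.deg (i + 1 + -1) at hx
      rwa [add_neg_cancel_right] at hx⟩
    have := isIso_of_bijective e Function.bijective_id
    refine ⟨(quot 𝒜).obj X, ⟨Iso.trans (Y := (quot 𝒜).obj ((shift 1).obj ((shift (-1)).obj Y)))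
      ⟨(quot 𝒜).map ((shift 1).map a), (quot 𝒜).map ((shift 1).map b), ?_, ?_⟩
      ((quot 𝒜).mapIso (asIso e))⟩⟩
    · exact ((quot 𝒜).map_comp _ _).symm.trans (((quot_map_eq_iff _ (𝟙 _)).2 (hab.shift 1)).trans
        ((quot 𝒜).map_id _))
    · exact ((quot 𝒜).map_comp _ _).symm.trans (((quot_map_eq_iff _ (𝟙 _)).2 (hba.shift 1)).trans
        ((quot 𝒜).map_id _))⟩

end GrStab

/-! ### Local endomorphism rings and Krull–Schmidt decompositions -/

/-- Nonzero quotients of local rings are local, without commutativity assumptions. -/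
theorem IsLocalRing.of_surjective_ringHom {R S : Type*} [Ring R] [Ring S] [IsLocalRing R]
    [Nontrivial S] (f : R →+* S) (hf : Function.Surjective f) : IsLocalRing S :=
  IsLocalRing.of_isUnit_or_isUnit_one_sub_self fun s => by
    obtain ⟨r, rfl⟩ := hf s
    refine (IsLocalRing.isUnit_or_isUnit_of_add_one (add_sub_cancel r 1)).imp
      (fun h => h.map f) fun h => ?_
    have := h.map f
    rwa [map_sub, map_one] at this

theorem IsLocalRing.eq_zero_or_eq_zero_of_mul_eq_zero {R : Type*} [Ring R] [IsLocalRing R]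
    {p q : R} (h : p + q = 1) (hpq : p * q = 0) (hqp : q * p = 0) : p = 0 ∨ q = 0 := by
  rcases IsLocalRing.isUnit_or_isUnit_of_add_one h with hu | hu
  · exact Or.inr (hu.mul_right_eq_zero.1 hpq)
  · exact Or.inl (hu.mul_right_eq_zero.1 hqp)

namespace CategoryTheory

section

variable {C : Type*} [Category* C] [Preadditive C]

theorem isLocalRing_end_of_iso {X Y : C} (e : X ≅ Y) (h : IsLocalRing (End X)) :
    IsLocalRing (End Y) := by
  let f : End X →+* End Y :=
    { e.conj.toMonoidHom with
      map_zero' := by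
        change e.inv ≫ (0 : X ⟶ X) ≫ e.hom = 0
        simp
      map_add' := fun a b => by
        change e.inv ≫ (show X ⟶ X from a + b) ≫ e.hom =
          e.inv ≫ (show X ⟶ X from a) ≫ e.hom + e.inv ≫ (show X ⟶ X from b) ≫ e.hom
        rw [← Preadditive.comp_add, ← Preadditive.add_comp] }
  have hf : Function.Bijective f := e.conj.bijective
  have : Nontrivial (End Y) := hf.1.nontrivial
  exact IsLocalRing.of_surjective_ringHom f hf.2

theorem not_isZero_of_isLocalRing_end {X : C} (h : IsLocalRing (End X)) : ¬ IsZero X := fun h0 =>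
  one_ne_zero (α := End X) ((IsZero.iff_id_eq_zero X).1 h0)

theorem nontrivial_end {X : C} (h : ¬ IsZero X) : Nontrivial (End X) :=
  ⟨𝟙 X, 0, fun h0 => h ((IsZero.iff_id_eq_zero X).2 h0)⟩

theorem indecomposable_of_isLocalRing_end [HasBinaryBiproducts C] {X : C}
    (h : IsLocalRing (End X)) : Indecomposable X := by
  refine ⟨not_isZero_of_isLocalRing_end h, fun Y Z e => ?_⟩
  let p : End X := e.hom ≫ biprod.fst ≫ biprod.inl ≫ e.inv
  let q : End X := e.hom ≫ biprod.snd ≫ biprod.inr ≫ e.inv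
  have hpq : p + q = 1 := by
    change e.hom ≫ biprod.fst ≫ biprod.inl ≫ e.inv + e.hom ≫ biprod.snd ≫ biprod.inr ≫ e.inv = 𝟙 X
    rw [← Preadditive.comp_add, ← Category.assoc biprod.fst, ← Category.assoc biprod.snd,
      ← Preadditive.add_comp, biprod.total]
    simp
  rcases IsLocalRing.eq_zero_or_eq_zero_of_mul_eq_zero hpq
    (show (e.hom ≫ biprod.snd ≫ biprod.inr ≫ e.inv) ≫ e.hom ≫ biprod.fst ≫ biprod.inl ≫ e.inv = 0
      by simp)
    (show (e.hom ≫ biprod.fst ≫ biprod.inl ≫ e.inv) ≫ e.hom ≫ biprod.snd ≫ biprod.inr ≫ e.inv = 0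
      by simp) with h0 | h0
  · left
    rw [IsZero.iff_id_eq_zero]
    have : biprod.inl ≫ e.inv ≫ (show X ⟶ X from p) ≫ e.hom ≫ biprod.fst = 𝟙 Y := by simp [p]
    rw [← this, h0]
    exact (by simp : biprod.inl ≫ e.inv ≫ (0 : X ⟶ X) ≫ e.hom ≫ biprod.fst = 0)
  · right
    rw [IsZero.iff_id_eq_zero]
    have : biprod.inr ≫ e.inv ≫ (show X ⟶ X from q) ≫ e.hom ≫ biprod.snd = 𝟙 Z := by simp [q]
    rw [← this, h0]
    exact (by simp : biprod.inr ≫ e.inv ≫ (0 : X ⟶ X) ≫ e.hom ≫ biprod.snd = 0)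

theorem Indecomposable.of_iso [HasBinaryBiproducts C] {X Y : C} (e : X ≅ Y)
    (h : Indecomposable X) : Indecomposable Y :=
  ⟨fun h0 => h.1 (h0.of_iso e), fun Z W e' => h.2 Z W (e ≪≫ e')⟩

end

section

variable {C : Type*} [Category* C] [Preadditive C] [HasFiniteBiproducts C]

/-- A direct sum over a disjoint union is the direct sum of the two partial direct sums. -/
noncomputable def biproductSumIso {ι κ : Type*} [Finite ι] [Finite κ] (Z : ι ⊕ κ → C) :
    (⨁ fun i => Z (Sum.inl i)) ⊞ (⨁ fun i => Z (Sum.inr i)) ≅ ⨁ Z where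
  hom := biprod.desc (biproduct.desc fun i => biproduct.ι Z (Sum.inl i))
    (biproduct.desc fun i => biproduct.ι Z (Sum.inr i))
  inv := biproduct.desc (Sum.rec (fun i => biproduct.ι (fun i => Z (Sum.inl i)) i ≫ biprod.inl)
    (fun i => biproduct.ι (fun i => Z (Sum.inr i)) i ≫ biprod.inr))
  hom_inv_id := by
    apply biprod.hom_ext' <;> apply biproduct.hom_ext' <;> intro i <;> simp
  inv_hom_id := by
    apply biproduct.hom_ext'
    rintro (i | i) <;> simp

/-- The object `X` is a finite direct sum of objects with local endomorphism rings. -/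
def HasLocalDecomposition (X : C) : Prop :=
  ∃ (n : ℕ) (Y : Fin n → C), (∀ i, IsLocalRing (End (Y i))) ∧ Nonempty (X ≅ ⨁ Y)

namespace HasLocalDecomposition

theorem of_iso {X X' : C} (e : X ≅ X') (h : HasLocalDecomposition X) :
    HasLocalDecomposition X' := by
  obtain ⟨n, Y, hY, ⟨e'⟩⟩ := h
  exact ⟨n, Y, hY, ⟨e.symm ≪≫ e'⟩⟩

theorem of_isZero {X : C} (h : IsZero X) : HasLocalDecomposition X :=
  ⟨0, Fin.elim0, fun i => i.elim0, ⟨h.iso ((IsZero.iff_id_eq_zero _).2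
    (biproduct.hom_ext _ _ fun i => i.elim0))⟩⟩

theorem of_isLocalRing {X : C} (h : IsLocalRing (End X)) : HasLocalDecomposition X :=
  ⟨1, fun _ => X, fun _ => h, ⟨{
    hom := biproduct.ι (fun _ : Fin 1 => X) 0
    inv := biproduct.π (fun _ : Fin 1 => X) 0
    hom_inv_id := biproduct.ι_π_self _ _
    inv_hom_id := biproduct.hom_ext' _ _ fun i => by
      obtain rfl : i = 0 := Subsingleton.elim _ _
      rw [biproduct.ι_π_self_assoc, Category.comp_id] }⟩⟩

theorem biprod {X X' : C} (h : HasLocalDecomposition X) (h' : HasLocalDecomposition X') :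
    HasLocalDecomposition (X ⊞ X') := by
  obtain ⟨n, Y, hY, ⟨e⟩⟩ := h
  obtain ⟨m, Y', hY', ⟨e'⟩⟩ := h'
  let Z : Fin n ⊕ Fin m → C := Sum.elim Y Y'
  let E : (⨁ Y) ⊞ (⨁ Y') ≅ ⨁ Z := biproductSumIso Z
  refine ⟨n + m, Z ∘ finSumFinEquiv.symm, fun i => ?_, ⟨biprod.mapIso e e' ≪≫ E ≪≫
    biproduct.whiskerEquiv finSumFinEquiv fun j => eqToIso (by simp)⟩⟩
  change IsLocalRing (End (Z (finSumFinEquiv.symm i)))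
  rcases finSumFinEquiv.symm i with i | i
  · exact hY i
  · exact hY' i

theorem map {D : Type*} [Category* D] [Preadditive D] [HasFiniteBiproducts D] (F : C ⥤ D)
    [F.Additive] (hF : ∀ X, IsLocalRing (End X) → IsLocalRing (End (F.obj X))) {X : C}
    (h : HasLocalDecomposition X) : HasLocalDecomposition (F.obj X) := by
  obtain ⟨n, Y, hY, ⟨e⟩⟩ := h
  exact ⟨n, F.obj ∘ Y, fun i => hF _ (hY i), ⟨F.mapIso e ≪≫ F.mapBiproduct Y⟩⟩

end HasLocalDecomposition

end

end CategoryTheory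

/-! ### Fitting decompositions of graded modules -/

namespace GrMod

variable {k : Type u} {A : Type v} [Field k] [Ring A] [Algebra k A] {𝒜 : ℤ → Submodule k A}

theorem lin_pow {X : GrMod 𝒜} (f : End X) (n : ℕ) :
    Hom.lin (show X ⟶ X from f ^ n) = (Hom.lin (show X ⟶ X from f) : Module.End Aᵐᵒᵖ X) ^ n := by
  induction n with
  | zero => rfl
  | succ n ih =>
    rw [pow_succ, pow_succ]
    exact congrArg (fun g : Module.End Aᵐᵒᵖ X => g * (Hom.lin (show X ⟶ X from f))) ih

variable [Module.Finite k A]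

theorem finrank_lt_of_ne_top {X : GrMod 𝒜} {N : Submodule Aᵐᵒᵖ X} (h : N ≠ ⊤) :
    Module.finrank k N < Module.finrank k X := by
  have : Module.Finite k X := Module.Finite.trans Aᵐᵒᵖ X
  refine Submodule.finrank_lt (s := N.restrictScalars k) fun h' => h ?_
  rwa [Submodule.restrictScalars_eq_top_iff] at h'

/-- A graded module with an endomorphism that is neither nilpotent nor invertible is the direct sum
of two graded modules of smaller dimension. -/
theorem exists_fitting {X : GrMod 𝒜} {f : End X} (hnil : ¬ IsNilpotent f) (hu : ¬ IsUnit f) :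
    ∃ Y Z : GrMod 𝒜, Module.finrank k Y < Module.finrank k X ∧
      Module.finrank k Z < Module.finrank k X ∧ Nonempty (Y ⊞ Z ≅ X) := by
  have : Module.Finite k X := Module.Finite.trans Aᵐᵒᵖ X
  have : IsArtinian Aᵐᵒᵖ X := isArtinian_of_tower k inferInstance
  have : IsNoetherian Aᵐᵒᵖ X := isNoetherian_of_tower k inferInstance
  obtain ⟨n, hn⟩ := Filter.eventually_atTop.1
    (LinearMap.eventually_isCompl_ker_pow_range_pow (Hom.lin (show X ⟶ X from f)))
  replace hn := hn (n + 1) (Nat.le_succ n)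
  rw [← lin_pow] at hn
  let g : X ⟶ X := f ^ (n + 1)
  change IsCompl (LinearMap.ker g.lin) (LinearMap.range g.lin) at hn
  have hK : ∀ i, ∀ x ∈ LinearMap.ker g.lin, X.component i x ∈ LinearMap.ker g.lin := by
    intro i x hx
    rw [LinearMap.mem_ker] at hx ⊢
    rw [map_component, hx, map_zero]
  have hI : ∀ i, ∀ x ∈ LinearMap.range g.lin, X.component i x ∈ LinearMap.range g.lin := by
    rintro i _ ⟨x, rfl⟩
    exact ⟨X.component i x, map_component g i x⟩
  have hKtop : LinearMap.ker g.lin ≠ ⊤ := fun h =>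
    hnil ⟨n + 1, hom_ext (LinearMap.ker_eq_top.1 h)⟩
  have hItop : LinearMap.range g.lin ≠ ⊤ := fun h => by
    have hbot : LinearMap.ker g.lin = ⊥ := by
      have := hn.disjoint
      rwa [h, disjoint_top] at this
    have : IsIso g := isIso_of_bijective g
      ⟨LinearMap.ker_eq_bot.1 hbot, LinearMap.range_eq_top.1 h⟩
    have hgu : IsUnit (f ^ (n + 1)) := (isUnit_iff_isIso (g : X ⟶ X)).2 this
    exact hu ((isUnit_pow_iff (Nat.succ_ne_zero n)).1 hgu)
  refine ⟨X.subObj _ hK, X.subObj _ hI, finrank_lt_of_ne_top hKtop, finrank_lt_of_ne_top hItop, ?_⟩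
  let s : prod (X.subObj _ hK) (X.subObj _ hI) ⟶ X :=
    ⟨(LinearMap.ker g.lin).subtype.coprod (LinearMap.range g.lin).subtype,
      fun i x hx => Submodule.add_mem _ hx.1 hx.2⟩
  have hs : IsIso s := isIso_of_bijective s (Submodule.prodEquivOfIsCompl _ _ hn).bijective
  let e := asIso s
  exact ⟨(biprod.uniqueUpToIso _ _ (b := prodBicone (X.subObj _ hK) (X.subObj _ hI))
    (isBinaryBilimitOfTotal _ (hom_ext (LinearMap.coprod_inl_inr ..)))).symm ≪≫ e⟩

end GrMod

namespace GrStab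

open GrMod

variable {k : Type u} {A : Type v} [Field k] [Ring A] [Algebra k A] {𝒜 : ℤ → Submodule k A}

variable [Module.Finite k A]

/-- Every object of the graded stable category is built by direct sums from zero objects and objects
with local endomorphism rings. -/
theorem induction_on {P : GrStab 𝒜 → Prop} (iso : ∀ X Y, (X ≅ Y) → P X → P Y)
    (zero : ∀ X, IsZero X → P X) (isLocal : ∀ X, IsLocalRing (End X) → P X)
    (biprod : ∀ X Y, P X → P Y → P (X ⊞ Y)) (X : GrStab 𝒜) : P X := by
  have := preservesBinaryBiproducts_of_preservesBiproducts (quot 𝒜)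
  have key : ∀ (d : ℕ) (X : GrMod 𝒜), Module.finrank k X < d → P ((quot 𝒜).obj X) := by
    intro d
    induction d with
    | zero => exact fun X h => absurd h (Nat.not_lt_zero _)
    | succ d ih =>
      intro X hd
      by_cases h : ∀ f : End X, IsNilpotent f ∨ IsUnit f
      · by_cases h0 : IsZero ((quot 𝒜).obj X)
        · exact zero _ h0
        · have := nontrivial_end h0
          refine isLocal _ (IsLocalRing.of_isUnit_or_isUnit_one_sub_self fun g => ?_)
          obtain ⟨f, rfl⟩ : ∃ f : End X, (quot 𝒜).map f = g := (quot 𝒜).map_surjective g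
          rcases h f with hf | hf
          · right
            obtain ⟨n, hn⟩ := hf
            refine IsNilpotent.isUnit_one_sub ⟨n, ?_⟩
            have hn' : Functor.mapEnd X (quot 𝒜) (f ^ n) = 0 := by
              rw [hn]
              exact (quot 𝒜).map_zero X X
            rw [map_pow] at hn'
            exact hn'
          · left
            exact hf.map (Functor.mapEnd X (quot 𝒜))
      · push Not at h
        obtain ⟨f, hnil, hu⟩ := h
        obtain ⟨Y, Z, hY, hZ, ⟨e⟩⟩ := exists_fitting hnil hu
        exact iso _ _ (((quot 𝒜).mapBiprod Y Z).symm ≪≫ (quot 𝒜).mapIso e)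
          (biprod _ _ (ih Y (by omega)) (ih Z (by omega)))
  exact key _ X.as (Nat.lt_succ_self _)

theorem hasLocalDecomposition (X : GrStab 𝒜) : HasLocalDecomposition X :=
  induction_on (fun _ _ e h => h.of_iso e) (fun _ h => .of_isZero h) (fun _ h => .of_isLocalRing h)
    (fun _ _ h h' => h.biprod h') X

/-- In the graded stable category, indecomposable objects have local endomorphism rings. -/
theorem isLocalRing_end_of_indecomposable {X : GrStab 𝒜} :
    Indecomposable X → IsLocalRing (End X) := by
  refine induction_on (P := fun X => Indecomposable X → IsLocalRing (End X))
    (fun X Y e hX hY => isLocalRing_end_of_iso e (hX (hY.of_iso e.symm)))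
    (fun X h hX => absurd h hX.1) (fun X h _ => h) (fun X Y hX hY h => ?_) X
  rcases h.2 X Y (Iso.refl _) with h0 | h0
  · have e : Y ≅ X ⊞ Y :=
      { hom := biprod.inr
        inv := biprod.snd
        inv_hom_id := biprod.hom_ext' _ _ (h0.eq_of_src _ _) (by simp) }
    exact isLocalRing_end_of_iso e (hY (h.of_iso e.symm))
  · have e : X ≅ X ⊞ Y :=
      { hom := biprod.inl
        inv := biprod.fst
        inv_hom_id := biprod.hom_ext' _ _ (by simp) (h0.eq_of_src _ _) }
    exact isLocalRing_end_of_iso e (hX (h.of_iso e.symm))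

end GrStab

/-! ### Endomorphism rings in an orbit category -/

namespace OrbitCategory

open DirectSum AutPow

variable {C : Type u} [Category.{v} C] [Preadditive C] (F : C ⥤ C) [F.IsEquivalence] [F.Additive]

instance npow_faithful (G : C ⥤ C) [G.Faithful] : ∀ n, (G.npow n).Faithful
  | 0 => inferInstanceAs (𝟭 C).Faithful
  | n + 1 =>
    have := npow_faithful G n
    inferInstanceAs (G.npow n ⋙ G).Faithful

section EndGrading

variable (X : C)

/-- The inclusion of the endomorphisms of degree `n`. -/
noncomputable def endHomog (n : ℤ) : (X ⟶ (F.zpow n).obj X) →+ End ((proj F).obj X) :=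
  DirectSum.of (fun n : ℤ => X ⟶ (F.zpow n).obj X) n

/-- The endomorphisms of degree `n` of an object of the orbit category. -/
noncomputable def endDeg (n : ℤ) : AddSubgroup (End ((proj F).obj X)) := (endHomog F X n).range

theorem endHomog_mul (i j : ℤ) (f : X ⟶ (F.zpow i).obj X) (g : X ⟶ (F.zpow j).obj X) :
    endHomog F X i f * endHomog F X j g =
      endHomog F X (i + j) (g ≫ (F.zpow j).map f ≫ (addIso F i j).inv.app X) :=
  compHom_homog F (X := of X) (Y := of X) (Z := of X) j i g f

theorem endAddHom_ext {N : Type*} [AddCommGroup N] {f g : End ((proj F).obj X) →+ N}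
    (h : ∀ n x, f (endHomog F X n x) = g (endHomog F X n x)) : f = g :=
  DirectSum.addHom_ext h

/-- The decomposition of an endomorphism into homogeneous components. -/
noncomputable def endDecompose : End ((proj F).obj X) →+ ⨁ n, endDeg F X n :=
  DirectSum.toAddMonoid fun n =>
    (DirectSum.of (fun n => endDeg F X n) n).comp (endHomog F X n).rangeRestrict

theorem endDecompose_homog (n : ℤ) (x : X ⟶ (F.zpow n).obj X) :
    endDecompose F X (endHomog F X n x) =
      DirectSum.of (fun n => endDeg F X n) n ⟨endHomog F X n x, x, rfl⟩ :=
  DirectSum.toAddMonoid_of _ _ _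

/-- The grading of the endomorphism ring. The product of elements of degrees `i` and `j` has degree
`i + j`, as multiplication in `End` is composition in the order opposite to `≫`. -/
noncomputable instance endGradedRing : GradedRing (endDeg F X) where
  one_mem := ⟨(zeroIso F).inv.app X, rfl⟩
  mul_mem := by
    rintro i j _ _ ⟨f, rfl⟩ ⟨g, rfl⟩
    exact ⟨_, (endHomog_mul F X i j f g).symm⟩
  toDecomposition := DirectSum.Decomposition.ofAddHom (endDeg F X) (endDecompose F X)
    (endAddHom_ext F X fun n x => by
      rw [AddMonoidHom.comp_apply, endDecompose_homog, DirectSum.coeAddMonoidHom_of]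
      rfl)
    (DirectSum.addHom_ext fun n => by
      rintro ⟨_, x, rfl⟩
      rw [AddMonoidHom.comp_apply, DirectSum.coeAddMonoidHom_of, endDecompose_homog]
      rfl)

/-- The component of degree zero in the grading of the endomorphism ring is the one described by
`OrbitCategory.degZero`. -/
theorem decompose_zero (f : End ((proj F).obj X)) :
    (DirectSum.decompose (endDeg F X) f 0 : End ((proj F).obj X)) =
      (proj F).map (degZero F f) := by
  let φ : End ((proj F).obj X) →+ End ((proj F).obj X) :=
    ((endDeg F X 0).subtype.comp (DFinsupp.evalAddMonoidHom 0)).comp (endDecompose F X)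
  let ψ : End ((proj F).obj X) →+ End ((proj F).obj X) :=
    (endHomog F X 0).comp (DFinsupp.evalAddMonoidHom (β := fun n : ℤ => X ⟶ (F.zpow n).obj X) 0)
  have h : φ = ψ := endAddHom_ext F X fun n x => by
    change ((endDecompose F X (endHomog F X n x) 0 : endDeg F X 0) : End ((proj F).obj X)) =
      endHomog F X 0 ((DirectSum.of (fun n : ℤ => X ⟶ (F.zpow n).obj X) n x) 0)
    rw [endDecompose_homog]
    by_cases hn : n = 0
    · subst hn
      rw [DirectSum.of_eq_same, DirectSum.of_eq_same]
    · rw [DirectSum.of_eq_of_ne _ _ _ (Ne.symm hn), DirectSum.of_eq_of_ne _ _ _ (Ne.symm hn),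
        map_zero]
      rfl
  refine (DFunLike.congr_fun h f).trans ?_
  change endHomog F X 0 ((show Hom F (of X) (of X) from f) 0) =
    endHomog F X 0 (degZero F f ≫ (zeroIso F).inv.app X)
  have : degZero F f ≫ (zeroIso F).inv.app X = (show Hom F (of X) (of X) from f) 0 := by
    change ((show Hom F (of X) (of X) from f) 0 ≫ (zeroIso F).hom.app X) ≫
      (zeroIso F).inv.app X = _
    rw [Category.assoc, Iso.hom_inv_id_app]
    exact Category.comp_id _
  rw [this]

instance proj_faithful : (proj F).Faithful where
  map_injective {X Y} f g h := by
    have h' := DirectSum.of_injective (β := fun n : ℤ => X ⟶ (F.zpow n).obj Y) 0 h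
    exact (cancel_mono ((zeroIso F).inv.app Y)).1 h'

/-- The embedding of the endomorphism ring of `X` as the subring of endomorphisms of degree zero. -/
noncomputable def projEnd : End X →+* End ((proj F).obj X) :=
  { Functor.mapEnd X (proj F) with
    map_zero' := (proj F).map_zero X X
    map_add' := fun _ _ => (proj F).map_add }

theorem mem_endDeg_zero_iff (x : End ((proj F).obj X)) :
    x ∈ endDeg F X 0 ↔ ∃ s, projEnd F X s = x := by
  constructor
  · intro hx
    exact ⟨degZero F x, (decompose_zero F X x).symm.trans
      (DirectSum.decompose_of_mem_same (endDeg F X) hx)⟩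
  · rintro ⟨s, rfl⟩
    exact ⟨_, rfl⟩

end EndGrading

variable {F} {X : C} {N : ℕ}
  (hN : ∀ n : ℤ, (N : ℤ) < |n| → ∀ f : X ⟶ (F.zpow n).obj X, f = 0)

include hN

theorem endDeg_eq_bot (n : ℤ) (hn : (N : ℤ) < |n|) : endDeg F X n = ⊥ := by
  rw [eq_bot_iff]
  rintro _ ⟨f, rfl⟩
  rw [hN n hn f, map_zero]
  exact zero_mem _

/-- If `Hom(X, Fⁿ X)` vanishes for large `|n|`, then the image of `X` in the orbit category has a
local endomorphism ring if `X` has. -/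
theorem isLocalRing_end_proj (h : IsLocalRing (End X)) : IsLocalRing (End ((proj F).obj X)) :=
  GradedLocal.isLocalRing (endDeg F X) (projEnd F X) (proj F).map_injective (endDeg_eq_bot hN)
    (mem_endDeg_zero_iff F X)

theorem mem_jacobson_end_proj_iff (h : IsLocalRing (End X)) (f : End ((proj F).obj X)) :
    f ∈ Ring.jacobson (End ((proj F).obj X)) ↔ degZero F f ∈ Ring.jacobson (End X) :=
  GradedLocal.mem_jacobson_iff (endDeg F X) (projEnd F X) (proj F).map_injective (endDeg_eq_bot hN)
    (mem_endDeg_zero_iff F X) (decompose_zero F X f).symm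

end OrbitCategory

namespace CategoryTheory

/-- Faithful additive functors reflect indecomposability. -/
theorem Indecomposable.of_map {C : Type*} [Category* C] [Preadditive C] [HasFiniteBiproducts C]
    {D : Type*} [Category* D] [Preadditive D] [HasFiniteBiproducts D] (F : C ⥤ D) [F.Additive]
    [F.Faithful] {X : C} (h : Indecomposable (F.obj X)) : Indecomposable X := by
  have hzero : ∀ {Y : C}, IsZero (F.obj Y) → IsZero Y := fun {Y} hY => by
    rw [IsZero.iff_id_eq_zero] at hY ⊢
    apply F.map_injective
    rw [F.map_id, F.map_zero, hY]
  have := preservesBinaryBiproducts_of_preservesBiproducts F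
  refine ⟨fun h0 => h.1 (F.map_isZero h0), fun Y Z e => ?_⟩
  exact (h.2 _ _ (F.mapIso e ≪≫ F.mapBiprod Y Z)).imp hzero hzero

end CategoryTheory

/-! ### Bounds on the degrees of syzygies -/

namespace GrStab

open GrMod

variable {k : Type u} {A : Type v} [Field k] [Ring A] [Algebra k A] {𝒜 : ℤ → Submodule k A}
  [Module.Finite k A] [GradedAlgebra 𝒜]

theorem omegaDeg_eq_bot (hneg : ∀ i : ℤ, 0 < i → 𝒜 i = ⊥) {X : GrMod 𝒜} {b : ℤ}
    (hb : ∀ i, b < i → X.deg i = ⊥) {n : ℤ} (hn : b < n) : omegaDeg X n = ⊥ := by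
  have h : GradedAux.tensorDeg 𝒜 X.deg n = ⊥ := by
    rw [eq_bot_iff]
    refine Submodule.span_le.2 ?_
    rintro _ ⟨i, j, rfl, a, ha, x, hx, rfl⟩
    rcases lt_or_ge 0 i with hi | hi
    · rw [hneg i hi, Submodule.mem_bot] at ha
      rw [ha, TensorProduct.zero_tmul]
      exact zero_mem _
    · rw [hb j (by omega), Submodule.mem_bot] at hx
      rw [hx, TensorProduct.tmul_zero]
      exact zero_mem _
  rw [eq_bot_iff]
  intro t ht
  have ht' : omegaIncl X t ∈ GradedAux.tensorDeg 𝒜 X.deg n := ht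
  rw [h, Submodule.mem_bot] at ht'
  exact omegaIncl_injective X (ht'.trans (map_zero _).symm)

/-- As `A` lives in nonpositive degrees, each application of `Ω(1)` lowers an upper bound for the
degrees of a graded module by one. -/
theorem npow_deg_eq_bot (hneg : ∀ i : ℤ, 0 < i → 𝒜 i = ⊥) {X : GrStab 𝒜} {b : ℤ}
    (hb : ∀ i, b < i → X.as.deg i = ⊥) (n : ℕ) :
    ∀ i, b - n < i → (((omegaShift 𝒜).npow n).obj X).as.deg i = ⊥ := by
  induction n with
  | zero => exact fun i hi => hb i (by simpa using hi)
  | succ n ih =>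
    intro i hi
    exact omegaDeg_eq_bot hneg ih (n := i + 1) (by push_cast at hi; omega)

theorem hom_eq_zero {X Y : GrStab 𝒜} (h : ∀ i, X.as.deg i = ⊥ ∨ Y.as.deg i = ⊥) (f : X ⟶ Y) :
    f = 0 := by
  obtain ⟨f, rfl⟩ : ∃ g : X.as ⟶ Y.as, (quot 𝒜).map g = f := (quot 𝒜).map_surjective f
  have hf : f = 0 := hom_ext_deg fun n x hx => by
    rcases h n with hn | hn
    · rw [hn, Submodule.mem_bot] at hx
      rw [hx, map_zero, map_zero]
    · have := f.map_deg n x hx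
      rw [hn, Submodule.mem_bot] at this
      exact this
  rw [hf]
  exact (quot 𝒜).map_zero _ _

theorem exists_deg_bounds (X : GrStab 𝒜) :
    ∃ b : ℕ, ∀ i : ℤ, (b : ℤ) < |i| → X.as.deg i = ⊥ := by
  obtain ⟨s, hs⟩ := X.as.exists_finset_deg_eq_bot
  refine ⟨s.sup Int.natAbs, fun i hi => hs i fun his => ?_⟩
  have := Finset.le_sup (f := Int.natAbs) his
  rw [Int.abs_eq_natAbs] at hi
  omega

/-- For `n` large, the module representing `Ωⁿ(n) Y` lives in degrees below those of `X`, and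
`Hom(X, Ω⁻ⁿ(-n) Y) ≅ Hom(Ωⁿ(n) X, Y)`, so that both sides of the orbit category are bounded. -/
theorem exists_hom_zpow_eq_zero (hneg : ∀ i : ℤ, 0 < i → 𝒜 i = ⊥) [(omegaShift 𝒜).IsEquivalence]
    (X Y : GrStab 𝒜) :
    ∃ N : ℕ, ∀ n : ℤ, (N : ℤ) < |n| → ∀ f : X ⟶ ((omegaShift 𝒜).zpow n).obj Y, f = 0 := by
  obtain ⟨b, hb⟩ := exists_deg_bounds X
  obtain ⟨c, hc⟩ := exists_deg_bounds Y
  have hnonneg : ∀ m : ℕ, b + c < m → ∀ f : X ⟶ ((omegaShift 𝒜).npow m).obj Y, f = 0 := by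
    refine fun m hm f => hom_eq_zero (fun i => ?_) f
    rcases lt_or_ge i (-b) with hi | hi
    · exact Or.inl (hb i (lt_abs.2 (Or.inr (by omega))))
    · exact Or.inr (npow_deg_eq_bot hneg (b := c)
        (fun i hi => hc i (lt_abs.2 (Or.inl hi))) m i (by omega))
  have hnonpos : ∀ m : ℕ, b + c < m → ∀ f : ((omegaShift 𝒜).npow m).obj X ⟶ Y, f = 0 := by
    refine fun m hm f => hom_eq_zero (fun i => ?_) f
    rcases lt_or_ge i (-c) with hi | hi
    · exact Or.inr (hc i (lt_abs.2 (Or.inr (by omega))))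
    · exact Or.inl (npow_deg_eq_bot hneg (b := b)
        (fun i hi => hb i (lt_abs.2 (Or.inl hi))) m i (by omega))
  refine ⟨b + c, fun n hn f => ?_⟩
  rcases Int.eq_nat_or_neg n with ⟨m, rfl | rfl⟩
  · rw [Nat.abs_cast] at hn
    exact hnonneg m (by exact_mod_cast hn) f
  · rw [abs_neg, Nat.abs_cast] at hn
    let e : ((omegaShift 𝒜).npow m).obj (((omegaShift 𝒜).zpow (-m)).obj Y) ≅ Y :=
      ((AutPow.addIso (omegaShift 𝒜) (-m) m).symm.app Y) ≪≫
        eqToIso (by rw [neg_add_cancel]) ≪≫ (OrbitCategory.zeroIso (omegaShift 𝒜)).app Y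
    have h := hnonpos m (by exact_mod_cast hn) (((omegaShift 𝒜).npow m).map f ≫ e.hom)
    have h' : ((omegaShift 𝒜).npow m).map f = 0 := by
      rw [← cancel_mono e.hom, h, zero_comp]
    exact ((omegaShift 𝒜).npow m).map_injective (h'.trans (Functor.map_zero _ _ _).symm)

end GrStab

theorem mainTheorem11 {k : Type u} {A : Type v} [Field k] [Ring A] [Algebra k A]
    [Module.Finite k A] (𝒜 : ℤ → Submodule k A) [GradedAlgebra 𝒜]
    (hneg : ∀ i : ℤ, 0 < i → 𝒜 i = ⊥) (hinj : Module.Injective Aᵐᵒᵖ A) :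
    ∃ _ : (GrStab.omegaShift 𝒜).IsEquivalence,
      IsKrullSchmidt (OrbitCategory (GrStab.omegaShift 𝒜)) ∧
      ∀ X : GrStab 𝒜,
        (Indecomposable ((OrbitCategory.proj (GrStab.omegaShift 𝒜)).obj X) ↔ Indecomposable X) ∧
        (Indecomposable X →
          IsLocalRing (End ((OrbitCategory.proj (GrStab.omegaShift 𝒜)).obj X)) ∧
          ∀ f : End ((OrbitCategory.proj (GrStab.omegaShift 𝒜)).obj X),
            f ∈ Ring.jacobson (End ((OrbitCategory.proj (GrStab.omegaShift 𝒜)).obj X)) ↔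
              OrbitCategory.degZero (GrStab.omegaShift 𝒜) f ∈ Ring.jacobson (End X)) := by
  have hF := GrStab.omegaShift_isEquivalence (𝒜 := 𝒜) hinj
  have hlocal : ∀ X : GrStab 𝒜, IsLocalRing (End X) →
      IsLocalRing (End ((OrbitCategory.proj (GrStab.omegaShift 𝒜)).obj X)) := fun X hX => by
    obtain ⟨N, hN⟩ := GrStab.exists_hom_zpow_eq_zero hneg X X
    exact OrbitCategory.isLocalRing_end_proj hN hX
  refine ⟨hF, fun X => ?_, fun X => ⟨⟨?_, fun hX => ?_⟩, fun hX => ⟨?_, fun f => ?_⟩⟩⟩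
  · exact (GrStab.hasLocalDecomposition X.obj).map (OrbitCategory.proj (GrStab.omegaShift 𝒜)) hlocal
  · exact Indecomposable.of_map (OrbitCategory.proj (GrStab.omegaShift 𝒜))
  · exact indecomposable_of_isLocalRing_end
      (hlocal X (GrStab.isLocalRing_end_of_indecomposable hX))
  · exact hlocal X (GrStab.isLocalRing_end_of_indecomposable hX)
  · obtain ⟨N, hN⟩ := GrStab.exists_hom_zpow_eq_zero hneg X X
    exact OrbitCategory.mem_jacobson_end_proj_iff hN
      (GrStab.isLocalRing_end_of_indecomposable hX) f
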